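/- Let $\mathcal{A}'$ be the class of functions $f=e^{-\varphi}$ on $\mathbb{R}^n$ with $\varphi:\mathbb{R}^n\to\mathbb{R}$ convex, twice continuously differentiable with positive definite Hessian at every point, and $\varphi(x)/\|x\|\to+\infty$, $\varphi(x)\to+\infty$ as $\|x\|\to\infty$. For log-concave $f=e^{-\varphi}$, $g=e^{-\psi}$ put $J(f)=\int_{\mathbb{R}^n}f\,dx$, $h_f(y)=\varphi^*(y)=\sup_x\{\langle x,y\rangle-\varphi(x)\}$, $f^\circ=e^{-\varphi^*}$, let $\mu_f=(\nabla\varphi)_\sharp(f\,dx)$ be the surface area measure of $f$, let $(f\oplus t\cdot g)(x)=\exp\left(-\inf_{y}\{\varphi(x-y)+t\,\psi(y/t)\}\right)$ for $t>0$, and let $\delta J(f,g)=\lim_{t\to0^+}\frac{J(f\oplus t\cdot g)-J(f)}{t}$ whenever this limit exists in $\mathbb{R}$. For $T\in\mathrm{GL}(n)$ let $\gamma_T(x)=e^{-\|Tx\|^2/2}$, and let $c_n=(2\pi)^{n/2}$. Problem $S_{\log}$ for $f$ is to maximize $J(\gamma_T)/c_n$ over all Gaussian functions $\gamma_T$, $T\in\mathrm{GL}(n)$,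 for which $\delta J(f,\gamma_T)$ exists and $\delta J(f,\gamma_T)/J(f)\le 1$. Let $f\in\mathcal{A}'$ with $\int_{\mathbb{R}^n}\|x\|^2\,d\mu_f(x)<\infty$. Then problem $S_{\log}$ for $f$ has exactly one solution (as a function $\gamma_T$). Moreover, for every $T\in\mathrm{GL}(n)$, the Gaussian function $\gamma_T$ solves $S_{\log}$ if and only if $$h_{\gamma_T^{\circ}}(y)=\frac{n}{4J(f)}\int_{\mathbb{R}^n}|\langle x,y\rangle|^2\,d\mu_f(x)\qquad\text{for all } y\in\mathbb{R}^n .$$ -/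

import Mathlib

open MeasureTheory Filter Topology

namespace LogConcave

noncomputable section

/-- Euclidean space `ℝⁿ`. -/
abbrev Rn (n : ℕ) : Type := EuclideanSpace ℝ (Fin n)

/-! ### Convex functions with values in `ℝ ∪ {+∞}` -/

/-- `φ` is a convex function `ℝⁿ → ℝ ∪ {+∞}`. -/
def IsConvexFun {n : ℕ} (φ : Rn n → EReal) : Prop :=
  (∀ x, φ x ≠ ⊥) ∧
    ∀ x y : Rn n, ∀ l : ℝ, 0 ≤ l → l ≤ 1 →
      φ ((1 - l) • x + l • y) ≤ ((1 - l : ℝ) : EReal) * φ x + (l : EReal) * φ y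

/-- The domain of `φ`: the points at which `φ` takes a real value. -/
def dom {n : ℕ} (φ : Rn n → EReal) : Set (Rn n) := {x | φ x ≠ ⊥ ∧ φ x ≠ ⊤}

/-- The class of proper convex functions `φ` with `φ(x) → +∞` as `‖x‖ → ∞`. -/
def classL (n : ℕ) : Set (Rn n → EReal) :=
  {φ | IsConvexFun φ ∧ (dom φ).Nonempty ∧ Tendsto φ (cocompact (Rn n)) (𝓝 ⊤)}

/-- `C²₊(ℝⁿ)`: twice continuously differentiable, with positive definite Hessian everywhere. -/
def IsC2Plus {n : ℕ} (u : Rn n → ℝ) : Prop :=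
  ContDiff ℝ 2 u ∧ ∀ x v : Rn n, v ≠ 0 → 0 < fderiv ℝ (fderiv ℝ u) x v v

/-- The functions `φ` of the class `classL n` that are finite on all of `ℝⁿ`, belong to
`C²₊(ℝⁿ)`, and satisfy `φ(x) / ‖x‖ → +∞` as `‖x‖ → ∞`. -/
def classL' (n : ℕ) : Set (Rn n → EReal) :=
  {φ | φ ∈ classL n ∧ dom φ = Set.univ ∧ IsC2Plus (fun x => (φ x).toReal) ∧
    Tendsto (fun x => (φ x).toReal / ‖x‖) (cocompact (Rn n)) atTop}

/-- The Legendre conjugate `φ*(y) = sup_x (⟨x, y⟩ - φ(x))`. -/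
def legendre {n : ℕ} (φ : Rn n → EReal) (y : Rn n) : EReal :=
  ⨆ x : Rn n, ((inner ℝ x y : ℝ) : EReal) - φ x

/-- The infimal convolution `(φ □ ψ)(x) = inf_y (φ(x - y) + ψ(y))`. -/
def infConv {n : ℕ} (φ ψ : Rn n → EReal) (x : Rn n) : EReal :=
  ⨅ y : Rn n, φ (x - y) + ψ y

/-- The right scalar multiplication `(φα)(x) = α φ(x / α)`, for `α > 0`. -/
def rightMul {n : ℕ} (φ : Rn n → EReal) (a : ℝ) (x : Rn n) : EReal :=
  (a : EReal) * φ (a⁻¹ • x)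

/-! ### Log-concave functions -/

/-- The function `e^{-φ}`, with `e^{-∞} = 0`. -/
def expNeg {n : ℕ} (φ : Rn n → EReal) (x : Rn n) : ℝ := (EReal.exp (-φ x)).toReal

/-- The function `-log f`, with `-log 0 = +∞`; it is inverse to `expNeg` on
functions with values in `ℝ ∪ {+∞}`. -/
def negLog {n : ℕ} (f : Rn n → ℝ) (x : Rn n) : EReal := -ENNReal.log (ENNReal.ofReal (f x))

theorem negLog_expNeg {n : ℕ} (φ : Rn n → EReal) (h : ∀ x, φ x ≠ ⊥) :
    negLog (expNeg φ) = φ := by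
  funext x
  have h1 : EReal.exp (-φ x) ≠ ⊤ := by
    intro h2
    rw [EReal.exp_eq_top_iff, EReal.neg_eq_top_iff] at h2
    exact h x h2
  simp [negLog, expNeg, ENNReal.ofReal_toReal h1]

/-- The functions `f = e^{-φ}` with `φ` in `classL' n`. -/
def classA' (n : ℕ) : Set (Rn n → ℝ) := {f | ∃ φ ∈ classL' n, f = expNeg φ}

/-- The total mass `J(f) = ∫ f dx`. -/
def totalMass {n : ℕ} (f : Rn n → ℝ) : ℝ := ∫ x, f x

/-- The support function `h_f = (-log f)*`. -/
def supportFun {n : ℕ} (f : Rn n → ℝ) : Rn n → EReal := legendre (negLog f)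

/-- The polar function `f° = e^{-(-log f)*}`. -/
def polar {n : ℕ} (f : Rn n → ℝ) : Rn n → ℝ := expNeg (legendre (negLog f))

/-- The sum `α · f ⊕ β · g`, for `α, β > 0`. -/
def asplundSum {n : ℕ} (a : ℝ) (f : Rn n → ℝ) (b : ℝ) (g : Rn n → ℝ) : Rn n → ℝ :=
  expNeg (infConv (rightMul (negLog f) a) (rightMul (negLog g) b))

/-- The first variation `δJ(f, g) = lim_{t → 0⁺} (J(f ⊕ t · g) - J(f)) / t` exists in `ℝ` and
equals `d`. -/
def HasFirstVariation {n : ℕ} (f g : Rn n → ℝ) (d : ℝ) : Prop :=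
  Tendsto (fun t : ℝ => (totalMass (asplundSum 1 f t g) - totalMass f) / t) (𝓝[>] 0) (𝓝 d)

/-- The surface area measure `μ_f = (∇(-log f))_♯ (f dx)`. -/
def surfaceAreaMeasure {n : ℕ} (f : Rn n → ℝ) : Measure (Rn n) :=
  Measure.map (fun x => gradient (fun z => -Real.log (f z)) x)
    ((volume : Measure (Rn n)).withDensity (fun x => ENNReal.ofReal (f x)))

/-! ### Gaussian functions and the extremal problem -/

/-- The Gaussian function `γ_T(x) = e^{-‖Tx‖² / 2}`, for `T ∈ GL(n)`. -/
def gaussian {n : ℕ} (T : Rn n ≃L[ℝ] Rn n) (x : Rn n) : ℝ := Real.exp (-(‖T x‖ ^ 2 / 2))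

/-- The constant `c_n = (2π)^{n/2}`. -/
def gaussConst (n : ℕ) : ℝ := (2 * Real.pi) ^ ((n : ℝ) / 2)

/-- The constraint of the problem `S_log`: the normalized first variation `δJ(f, g) / J(f)`
exists and is at most `1`. -/
def IsFeasible {n : ℕ} (f g : Rn n → ℝ) : Prop :=
  ∃ d : ℝ, HasFirstVariation f g d ∧ d / totalMass f ≤ 1

/-- `g` solves the problem `S_log` for `f`: among all Gaussian functions `γ_P`, `P ∈ GL(n)`, with
`δJ(f, γ_P) / J(f) ≤ 1`, the function `g` maximizes `J(γ_P) / c_n`. -/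
def IsSLogSolution {n : ℕ} (f g : Rn n → ℝ) : Prop :=
  (∃ T : Rn n ≃L[ℝ] Rn n, g = gaussian T) ∧ IsFeasible f g ∧
    ∀ P : Rn n ≃L[ℝ] Rn n, IsFeasible f (gaussian P) →
      totalMass (gaussian P) / gaussConst n ≤ totalMass g / gaussConst n

end

end LogConcave

namespace LogConcave

open scoped ENNReal Pointwise

/-! ### The Prékopa–Leindler inequality -/

/-! Write `f = e^{-u}`, `J = ∫ f`. The core is the formula `δJ(f, γ_T) = ∫ ‖T⁻*∇u‖²/2 · e^{-u}`
(`tendsto_lintegral_hopfLax`), which turns `S_log` into linear algebra.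

Lower bound: inserting `y = t T⁻¹T⁻*∇u(x)` into the supremum defining `f ⊕ t·γ_T` bounds the
pointwise difference quotients from below, and Fatou's lemma integrates this (`le_liminf`).

Upper bound: reverse Fatou needs an integrable majorant of the difference quotients, which is
available once `f` is replaced by `W²` with `W = (e^{-u/2} - ε)₊` Lipschitz, of bounded support and
still log-concave. By Prékopa–Leindler, `t ↦ J(W² ⊕ t·γ_T)` is log-concave, so the logarithmic
quotient at a fixed `t` is at most the difference quotient at every `s < t`. Letting `s → 0` bounds
it by an integral independent of `ε`. This bound at fixed `t` survives the monotone limit `ε → 0`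
(`log_div_le`), and only then does `t → 0`.

For the extremal problem, choose `T₀` with `‖T₀ v‖² = (n / 2J) ∫ ⟨x, v⟩² dμ_f`. For `S = T₀P⁻¹` the
constraint on `γ_P` reads `tr(S*S) ≤ n`, while `J(γ_P)/c_n = |det P|⁻¹`. AM–GM for the eigenvalues
of `S*S` gives `|det S| ≤ 1`, with equality only for isometries. Hence the maximizers are the `γ_P`
with `‖P y‖ = ‖T₀ y‖` for all `y`, which is one function, and `h_{γ_P°}(y) = ‖P y‖²/2` yields the
stated equation. -/

theorem volume_affine_image (a c : ℝ) (ha : 0 < a) (K : Set ℝ) :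
    volume ((fun x => a * x + c) '' K) = ENNReal.ofReal a * volume K := by
  have h1 : (fun x => a * x + c) '' K = (fun z => z + c) '' (a • K) := by
    rw [← Set.image_smul, Set.image_image]; simp [smul_eq_mul]
  rw [h1, Set.image_add_right, measure_preimage_add_right, Measure.addHaar_smul]
  simp [abs_of_pos ha]

/-- One-dimensional Brunn–Minkowski: with `k = max K` and `l = min L`, the sets `aK + bl` and `ak +
bL` both lie in `C` and meet at most in the point `ak + bl`. -/
theorem volume_combo_le_of_isCompact {K L C : Set ℝ} (hK : IsCompact K) (hL : IsCompact L)
    (hKn : K.Nonempty) (hLn : L.Nonempty) {a b : ℝ} (ha : 0 < a) (hb : 0 < b)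
    (h : ∀ x ∈ K, ∀ y ∈ L, a * x + b * y ∈ C) :
    ENNReal.ofReal a * volume K + ENNReal.ofReal b * volume L ≤ volume C := by
  obtain ⟨k, hkK, hk⟩ := hK.exists_isGreatest hKn
  obtain ⟨l, hlL, hl⟩ := hL.exists_isLeast hLn
  rw [← volume_affine_image a (b * l) ha K, ← volume_affine_image b (a * k) hb L,
    ← measure_union_add_inter]
  · have h0 : volume ((fun x => a * x + b * l) '' K ∩ (fun x => b * x + a * k) '' L) = 0 := by
      refine measure_mono_null (t := {a * k + b * l}) ?_ (by simp)
      rintro z ⟨⟨x, hx, rfl⟩, ⟨y, hy, hxy⟩⟩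
      have h1 := mul_le_mul_of_nonneg_left (hk hx) ha.le
      have h2 := mul_le_mul_of_nonneg_left (hl hy) hb.le
      simp only [Set.mem_singleton_iff] at *
      linarith
    rw [h0, add_zero]
    apply measure_mono
    rintro z (⟨x, hx, rfl⟩ | ⟨y, hy, rfl⟩)
    · exact h x hx l hlL
    · have := h k hkK y hy
      simpa [add_comm] using this
  · exact (hL.image (by fun_prop)).measurableSet

theorem volume_combo_le {A B C : Set ℝ} (hA : MeasurableSet A) (hB : MeasurableSet B)
    (hAn : A.Nonempty) (hBn : B.Nonempty) {a b : ℝ} (ha : 0 < a) (hb : 0 < b)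
    (h : ∀ x ∈ A, ∀ y ∈ B, a * x + b * y ∈ C) :
    ENNReal.ofReal a * volume A + ENNReal.ofReal b * volume B ≤ volume C := by
  obtain ⟨x₀, hx₀⟩ := hAn
  obtain ⟨y₀, hy₀⟩ := hBn
  have key : ∀ K ⊆ A, IsCompact K → ∀ L ⊆ B, IsCompact L →
      ENNReal.ofReal a * volume K + ENNReal.ofReal b * volume L ≤ volume C := by
    intro K hKA hK L hLB hL
    -- Adjoining fixed points of `A` and `B` makes the approximating compact sets nonempty.
    refine le_trans ?_ (volume_combo_le_of_isCompact (hK.insert x₀) (hL.insert y₀)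
      (Set.insert_nonempty _ _) (Set.insert_nonempty _ _) ha hb
      fun x hx y hy => h x (Set.insert_subset hx₀ hKA hx) y (Set.insert_subset hy₀ hLB hy))
    gcongr <;> exact Set.subset_insert _ _
  have hne : ∀ S : Set ℝ, Nonempty {K : Set ℝ // K ⊆ S ∧ IsCompact K} :=
    fun S => ⟨∅, Set.empty_subset _, isCompact_empty⟩
  have e : ∀ (S : Set ℝ) (F : Set ℝ → ℝ≥0∞), (⨆ (K) (_ : K ⊆ S) (_ : IsCompact K), F K) =
      ⨆ K : {K : Set ℝ // K ⊆ S ∧ IsCompact K}, F K := by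
    intro S F
    rw [iSup_subtype]
    simp only [iSup_and]
  rw [hA.measure_eq_iSup_isCompact, hB.measure_eq_iSup_isCompact, e A, e B]
  have := hne A
  have := hne B
  rw [ENNReal.mul_iSup, ENNReal.mul_iSup, ENNReal.iSup_add]
  refine iSup_le fun K => ?_
  rw [ENNReal.add_iSup]
  exact iSup_le fun L => key K K.2.1 K.2.2 L L.2.1 L.2.2

theorem ennreal_geom_mean_le {a b : ℝ} (ha : 0 < a) (hb : 0 < b) (hab : a + b = 1) (p q : ℝ≥0∞) :
    p ^ a * q ^ b ≤ ENNReal.ofReal a * p + ENNReal.ofReal b * q := by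
  rcases eq_or_ne p ⊤ with rfl | hp
  · rw [ENNReal.mul_top (by simpa using ha)]; simp
  rcases eq_or_ne q ⊤ with rfl | hq
  · rw [ENNReal.mul_top (by simpa using hb)]; simp
  lift p to NNReal using hp
  lift q to NNReal using hq
  have := NNReal.geom_mean_le_arith_mean2_weighted (⟨a, ha.le⟩ : NNReal) ⟨b, hb.le⟩ p q
    (by ext; exact hab)
  rw [← ENNReal.coe_rpow_of_nonneg _ ha.le, ← ENNReal.coe_rpow_of_nonneg _ hb.le,
    ENNReal.ofReal_eq_coe_nnreal ha.le, ENNReal.ofReal_eq_coe_nnreal hb.le]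
  exact_mod_cast this

/-- The layer cake formula for functions bounded by `1`. -/
theorem lintegral_eq_lintegral_Ioo_meas_lt {f : ℝ → ℝ≥0∞} (hf : Measurable f)
    (h1 : ∀ x, f x ≤ 1) :
    ∫⁻ x, f x = ∫⁻ s in Set.Ioo (0 : ℝ) 1, volume {x | ENNReal.ofReal s < f x} := by
  have hft : ∀ x, f x ≠ ⊤ := fun x => ne_top_of_le_ne_top ENNReal.one_ne_top (h1 x)
  have h2 : ∫⁻ x, f x = ∫⁻ x, ENNReal.ofReal (f x).toReal := by
    simp_rw [ENNReal.ofReal_toReal (hft _)]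
  rw [h2, lintegral_eq_lintegral_meas_lt _ (ae_of_all _ fun _ => ENNReal.toReal_nonneg)
    hf.ennreal_toReal.aemeasurable]
  have h3 : ∀ s ∈ Set.Ioi (0 : ℝ), volume {x | s < (f x).toReal} =
      (Set.Ioo (0 : ℝ) 1).indicator (fun s => volume {x | ENNReal.ofReal s < f x}) s := by
    intro s hs
    have hs' : 0 < s := hs
    by_cases hs1 : s < 1
    · rw [Set.indicator_of_mem (show s ∈ Set.Ioo (0 : ℝ) 1 from ⟨hs, hs1⟩)]
      congr 1
      ext x
      exact (ENNReal.ofReal_lt_iff_lt_toReal hs'.le (hft x)).symm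
    · rw [Set.indicator_of_notMem (fun h => hs1 h.2)]
      convert measure_empty (μ := (volume : Measure ℝ))
      ext x
      simp only [Set.mem_ofPred_eq, Set.mem_empty_iff_false, iff_false, not_lt]
      exact (ENNReal.toReal_mono ENNReal.one_ne_top (h1 x)).trans (by simpa using hs1)
  rw [setLIntegral_congr_fun measurableSet_Ioi h3, lintegral_indicator measurableSet_Ioo,
    Measure.restrict_restrict measurableSet_Ioo]
  congr 2
  exact Set.inter_eq_left.2 fun s hs => hs.1

/-- With both suprema equal to 1, the superlevel sets of `f` and `g` at each `s < 1` are nonempty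
and their combination lies in that of `h`. Brunn–Minkowski on the line is then integrated over `s`.
Replacing `h` by `min h 1` confines the layer cake formula to `(0, 1)`. -/
theorem lintegral_combo_le_of_iSup_eq_one {f g h : ℝ → ℝ≥0∞} (hf : Measurable f)
    (hg : Measurable g) (hh : Measurable h) (hf1 : ⨆ x, f x = 1) (hg1 : ⨆ x, g x = 1)
    {a b : ℝ} (ha : 0 < a) (hb : 0 < b) (hab : a + b = 1)
    (H : ∀ x y, f x ^ a * g y ^ b ≤ h (a * x + b * y)) :
    ENNReal.ofReal a * (∫⁻ x, f x) + ENNReal.ofReal b * (∫⁻ x, g x) ≤ ∫⁻ x, h x := by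
  have hf1' : ∀ x, f x ≤ 1 := fun x => hf1 ▸ le_iSup f x
  have hg1' : ∀ x, g x ≤ 1 := fun x => hg1 ▸ le_iSup g x
  have h2 : ∫⁻ x, min (h x) 1 ≤ ∫⁻ x, h x := lintegral_mono fun x => min_le_left _ _
  refine le_trans ?_ h2
  rw [lintegral_eq_lintegral_Ioo_meas_lt hf hf1', lintegral_eq_lintegral_Ioo_meas_lt hg hg1',
    lintegral_eq_lintegral_Ioo_meas_lt (hh.min measurable_const) fun x => min_le_right _ _]
  have anti : ∀ k : ℝ → ℝ≥0∞, Measurable fun s : ℝ => volume {x | ENNReal.ofReal s < k x} := by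
    intro k
    refine Antitone.measurable fun s t hst => measure_mono fun x hx => ?_
    exact (ENNReal.ofReal_le_ofReal hst).trans_lt hx
  rw [← lintegral_const_mul _ (anti f), ← lintegral_const_mul _ (anti g),
    ← lintegral_add_left ((anti f).const_mul _)]
  refine setLIntegral_mono (anti _) fun s hs => ?_
  have hs1 : ENNReal.ofReal s < 1 := by simpa using hs.2
  refine volume_combo_le (measurableSet_lt measurable_const hf)
    (measurableSet_lt measurable_const hg) ?_ ?_ ha hb ?_
  · exact lt_iSup_iff.1 (hf1 ▸ hs1)
  · exact lt_iSup_iff.1 (hg1 ▸ hs1)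
  · intro x hx y hy
    refine lt_min (lt_of_lt_of_le ?_ (H x y)) hs1
    have hx' : ENNReal.ofReal s < f x := hx
    have hy' : ENNReal.ofReal s < g y := hy
    have hs0 : ENNReal.ofReal s ≠ 0 := by simpa using hs.1
    calc ENNReal.ofReal s = ENNReal.ofReal s ^ a * ENNReal.ofReal s ^ b := by
          rw [← ENNReal.rpow_add _ _ hs0 ENNReal.ofReal_ne_top, hab, ENNReal.rpow_one]
      _ < f x ^ a * g y ^ b :=
          ENNReal.mul_lt_mul (ENNReal.rpow_lt_rpow hx' ha) (ENNReal.rpow_lt_rpow hy' hb)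

/-- Normalizing both suprema to 1 gives the stronger arithmetic-mean inequality; AM–GM weakens it to
a geometric mean, from which the scaling factor `D` cancels. -/
theorem prekopaLeindler_real_of_iSup_ne_top {f g h : ℝ → ℝ≥0∞} (hf : Measurable f)
    (hg : Measurable g) (hh : Measurable h) (hf1 : ⨆ x, f x ≠ ⊤) (hg1 : ⨆ x, g x ≠ ⊤)
    {a b : ℝ} (ha : 0 < a) (hb : 0 < b) (hab : a + b = 1)
    (H : ∀ x y, f x ^ a * g y ^ b ≤ h (a * x + b * y)) :
    (∫⁻ x, f x) ^ a * (∫⁻ x, g x) ^ b ≤ ∫⁻ x, h x := by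
  set A := ⨆ x, f x with hA
  set B := ⨆ x, g x with hB
  rcases eq_or_ne A 0 with h0 | hA0
  · have : ∀ x, f x = 0 := fun x => le_antisymm (h0 ▸ le_iSup f x) bot_le
    simp [this, ENNReal.zero_rpow_of_pos ha]
  rcases eq_or_ne B 0 with h0 | hB0
  · have : ∀ x, g x = 0 := fun x => le_antisymm (h0 ▸ le_iSup g x) bot_le
    simp [this, ENNReal.zero_rpow_of_pos hb]
  have hAi := ENNReal.inv_ne_top.2 hA0
  have hBi := ENNReal.inv_ne_top.2 hB0
  set D := A⁻¹ ^ a * B⁻¹ ^ b with hD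
  have hD0 : D ≠ 0 := mul_ne_zero
    (by simp [ENNReal.rpow_eq_zero_iff, hf1, ha, hA0])
    (by simp [ENNReal.rpow_eq_zero_iff, hg1, hb, hB0])
  have hDt : D ≠ ⊤ := ENNReal.mul_ne_top (ENNReal.rpow_ne_top_of_nonneg ha.le hAi)
    (ENNReal.rpow_ne_top_of_nonneg hb.le hBi)
  have key := lintegral_combo_le_of_iSup_eq_one (f := fun x => A⁻¹ * f x)
    (g := fun x => B⁻¹ * g x) (h := fun x => D * h x) (hf.const_mul _) (hg.const_mul _)
    (hh.const_mul _) (by rw [← ENNReal.mul_iSup, ENNReal.inv_mul_cancel hA0 hf1])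
    (by rw [← ENNReal.mul_iSup, ENNReal.inv_mul_cancel hB0 hg1]) ha hb hab (by
      intro x y
      rw [ENNReal.mul_rpow_of_nonneg _ _ ha.le, ENNReal.mul_rpow_of_nonneg _ _ hb.le,
        mul_mul_mul_comm]
      exact mul_le_mul_right (H x y) _)
  rw [lintegral_const_mul _ hf, lintegral_const_mul _ hg, lintegral_const_mul _ hh] at key
  have k2 := (ennreal_geom_mean_le ha hb hab _ _).trans key
  rw [ENNReal.mul_rpow_of_nonneg _ _ ha.le, ENNReal.mul_rpow_of_nonneg _ _ hb.le,
    mul_mul_mul_comm] at k2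
  exact (ENNReal.mul_le_mul_iff_right hD0 hDt).1 k2

theorem lintegral_eq_iSup_lintegral_min {α : Type*} [MeasurableSpace α] {μ : Measure α}
    {f : α → ℝ≥0∞} (hf : Measurable f) :
    ∫⁻ x, f x ∂μ = ⨆ N : ℕ, ∫⁻ x, min (f x) N ∂μ := by
  rw [← lintegral_iSup (fun N => hf.min measurable_const)
    fun N M hNM x => min_le_min_left _ (by exact_mod_cast hNM)]
  refine lintegral_congr fun x => ?_
  have := ENNReal.iSup_natCast
  rw [← inf_iSup_eq, this, inf_top_eq]

theorem iSup_rpow {ι : Type*} (F : ι → ℝ≥0∞) {a : ℝ} (ha : 0 < a) :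
    (⨆ i, F i) ^ a = ⨆ i, F i ^ a :=
  (ENNReal.orderIsoRpow a ha).map_iSup F

theorem prekopaLeindler_real {f g h : ℝ → ℝ≥0∞} (hf : Measurable f)
    (hg : Measurable g) (hh : Measurable h)
    {a b : ℝ} (ha : 0 < a) (hb : 0 < b) (hab : a + b = 1)
    (H : ∀ x y, f x ^ a * g y ^ b ≤ h (a * x + b * y)) :
    (∫⁻ x, f x) ^ a * (∫⁻ x, g x) ^ b ≤ ∫⁻ x, h x := by
  rw [lintegral_eq_iSup_lintegral_min hf, lintegral_eq_iSup_lintegral_min hg,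
    iSup_rpow _ ha, iSup_rpow _ hb, ENNReal.iSup_mul]
  refine iSup_le fun N => ?_
  rw [ENNReal.mul_iSup]
  refine iSup_le fun M => ?_
  have hb' : ∀ (k : ℝ → ℝ≥0∞) (N : ℕ), ⨆ x, min (k x) N ≠ ⊤ := fun k N =>
    ne_top_of_le_ne_top (ENNReal.natCast_ne_top N) (iSup_le fun x => min_le_right _ _)
  refine prekopaLeindler_real_of_iSup_ne_top (hf.min measurable_const)
    (hg.min measurable_const) hh (hb' f N) (hb' g M) ha hb hab fun x y => le_trans ?_ (H x y)
  gcongr <;> exact min_le_left _ _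

/-- Induction on the dimension: the inequality for slices is exactly the hypothesis of the
one-dimensional inequality for the slice integrals. -/
theorem prekopaLeindler_pi (n : ℕ) {f g h : (Fin n → ℝ) → ℝ≥0∞} (hf : Measurable f)
    (hg : Measurable g) (hh : Measurable h)
    {a b : ℝ} (ha : 0 < a) (hb : 0 < b) (hab : a + b = 1)
    (H : ∀ x y, f x ^ a * g y ^ b ≤ h (a • x + b • y)) :
    (∫⁻ x, f x) ^ a * (∫⁻ x, g x) ^ b ≤ ∫⁻ x, h x := by
  induction n with
  | zero =>
    have : ∀ k : (Fin 0 → ℝ) → ℝ≥0∞, ∫⁻ x, k x = k default := by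
      intro k
      rw [lintegral_unique]
      simp [volume_pi]
      congr 1
      exact Subsingleton.elim _ _
    rw [this, this, this]
    convert H default default
  | succ n ih =>
    have e := volume_preserving_piFinSuccAbove (fun _ : Fin (n + 1) => ℝ) 0
    have split : ∀ k : (Fin (n + 1) → ℝ) → ℝ≥0∞, Measurable k →
        ∫⁻ x, k x = ∫⁻ r : ℝ, ∫⁻ v : Fin n → ℝ, k (Fin.cons r v) := by
      intro k hk
      rw [← e.symm.lintegral_comp hk]
      have hk' : Measurable fun p : ℝ × (Fin n → ℝ) =>
          k ((MeasurableEquiv.piFinSuccAbove (fun _ : Fin (n + 1) => ℝ) 0).symm p) :=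
        hk.comp (MeasurableEquiv.measurable _)
      rw [Measure.volume_eq_prod, lintegral_prod _ hk'.aemeasurable]
      simp [MeasurableEquiv.piFinSuccAbove, Fin.insertNthEquiv]
    have mcons : Measurable fun p : ℝ × (Fin n → ℝ) => (Fin.cons p.1 p.2 : Fin (n + 1) → ℝ) := by
      convert (MeasurableEquiv.piFinSuccAbove (fun _ : Fin (n + 1) => ℝ) 0).symm.measurable using 2
      simp [MeasurableEquiv.piFinSuccAbove, Fin.insertNthEquiv]
    have mk : ∀ k : (Fin (n + 1) → ℝ) → ℝ≥0∞, Measurable k →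
        Measurable fun r : ℝ => ∫⁻ v : Fin n → ℝ, k (Fin.cons r v) := fun k hk =>
      Measurable.lintegral_prod_right' (f := fun p : ℝ × (Fin n → ℝ) => k (Fin.cons p.1 p.2))
        (hk.comp mcons)
    have ms : ∀ (k : (Fin (n + 1) → ℝ) → ℝ≥0∞), Measurable k → ∀ r : ℝ,
        Measurable fun v : Fin n → ℝ => k (Fin.cons r v) := fun k hk r =>
      hk.comp (mcons.comp (measurable_const.prodMk measurable_id))
    rw [split f hf, split g hg, split h hh]
    refine prekopaLeindler_real (mk f hf) (mk g hg) (mk h hh) ha hb hab fun r s => ?_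
    refine ih (ms f hf r) (ms g hg s) (ms h hh _) fun v w => ?_
    convert H (Fin.cons r v) (Fin.cons s w) using 2
    ext i
    refine Fin.cases ?_ (fun j => ?_) i <;> simp

/-- The **Prékopa–Leindler inequality** in Euclidean space. -/
theorem prekopaLeindler {n : ℕ} {f g h : Rn n → ℝ≥0∞} (hf : Measurable f)
    (hg : Measurable g) (hh : Measurable h)
    {a b : ℝ} (ha : 0 < a) (hb : 0 < b) (hab : a + b = 1)
    (H : ∀ x y, f x ^ a * g y ^ b ≤ h (a • x + b • y)) :
    (∫⁻ x, f x) ^ a * (∫⁻ x, g x) ^ b ≤ ∫⁻ x, h x := by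
  have e := PiLp.volume_preserving_toLp (Fin n)
  have hm : Measurable (WithLp.toLp 2 : (Fin n → ℝ) → Rn n) := e.measurable
  rw [← e.lintegral_comp hf, ← e.lintegral_comp hg, ← e.lintegral_comp hh]
  exact prekopaLeindler_pi n (hf.comp hm) (hg.comp hm) (hh.comp hm) ha hb hab
    fun x y => H _ _

/-! ### The Hopf–Lax type semigroup of a Gaussian -/

section Gaussian

/-- The sum `f ⊕ t · γ_T` for functions with values in `[0, ∞]`. -/
noncomputable def hopfLax {n : ℕ} (T : Rn n ≃L[ℝ] Rn n) (t : ℝ) (f : Rn n → ℝ≥0∞) (x : Rn n) :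
    ℝ≥0∞ :=
  ⨆ y, f (x - y) * ENNReal.ofReal (Real.exp (-(‖T y‖ ^ 2 / (2 * t))))

variable {n : ℕ} (T : Rn n ≃L[ℝ] Rn n)

theorem le_hopfLax (t : ℝ) (f : Rn n → ℝ≥0∞) (x : Rn n) : f x ≤ hopfLax T t f x := by
  refine le_trans ?_ (le_iSup _ 0)
  simp

theorem hopfLax_mono (t : ℝ) {f g : Rn n → ℝ≥0∞} (h : f ≤ g) :
    hopfLax T t f ≤ hopfLax T t g := fun x => by
  unfold hopfLax
  gcongr with y
  exact h _

/-- Two suprema commute; this carries the monotone limit of the truncations through the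
sup-convolution. -/
theorem hopfLax_iSup {ι : Type*} (t : ℝ) (f : ι → Rn n → ℝ≥0∞) (x : Rn n) :
    hopfLax T t (fun z => ⨆ k, f k z) x = ⨆ k, hopfLax T t (f k) x := by
  simp only [hopfLax, ENNReal.iSup_mul]
  exact iSup_comm

theorem measurable_hopfLax (t : ℝ) {f : Rn n → ℝ≥0∞} (hf : Continuous f) :
    Measurable (hopfLax T t f) := by
  have : LowerSemicontinuous (hopfLax T t f) := by
    refine lowerSemicontinuous_iSup fun y => Continuous.lowerSemicontinuous ?_
    exact (ENNReal.continuous_mul_const ENNReal.ofReal_ne_top).comp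
      (hf.comp (continuous_id.sub continuous_const))
  exact this.measurable

/-- If `z` competes at `y` and time `t`, then `b • z` competes at `a • x + b • y` and time `b * t`,
since `‖T(bz)‖²/(2bt) = b‖Tz‖²/(2t)`. -/
theorem rpow_mul_hopfLax_rpow_le {t a b : ℝ} (ht : 0 < t) (hb : 0 < b)
    {f : Rn n → ℝ≥0∞} (hf : ∀ x y, f x ^ a * f y ^ b ≤ f (a • x + b • y)) (x y : Rn n) :
    f x ^ a * hopfLax T t f y ^ b ≤ hopfLax T (b * t) f (a • x + b • y) := by
  unfold hopfLax
  rw [iSup_rpow _ hb, ENNReal.mul_iSup]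
  refine iSup_le fun z => le_trans ?_ (le_iSup _ (b • z))
  rw [ENNReal.mul_rpow_of_nonneg _ _ hb.le, ← mul_assoc]
  have e : a • x + b • y - b • z = a • x + b • (y - z) := by rw [smul_sub]; abel
  rw [e]
  refine mul_le_mul' (hf _ _) (le_of_eq ?_)
  rw [ENNReal.ofReal_rpow_of_pos (Real.exp_pos _), ← Real.exp_mul]
  congr 2
  rw [map_smul, norm_smul, Real.norm_eq_abs, mul_pow, sq_abs]
  field_simp

theorem lintegral_rpow_mul_hopfLax_rpow_le {t a b : ℝ} (ht : 0 < t) (ha : 0 < a) (hb : 0 < b)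
    (hab : a + b = 1) {f : Rn n → ℝ≥0∞} (hfc : Continuous f)
    (hf : ∀ x y, f x ^ a * f y ^ b ≤ f (a • x + b • y)) :
    (∫⁻ x, f x) ^ a * (∫⁻ x, hopfLax T t f x) ^ b ≤ ∫⁻ x, hopfLax T (b * t) f x :=
  prekopaLeindler hfc.measurable (measurable_hopfLax T t hfc) (measurable_hopfLax T _ hfc)
    ha hb hab (rpow_mul_hopfLax_rpow_le T ht hb hf)

/-- Quantitative consequence of log-concavity of `t ↦ J(f ⊕ t · γ)`. -/
theorem log_div_le_of_rpow {J Jt Js t s : ℝ} (hJ : 0 < J) (hJt : 0 < Jt) (hs : 0 < s)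
    (h : J ^ (1 - s / t) * Jt ^ (s / t) ≤ Js) :
    Real.log (Jt / J) * J / t ≤ (Js - J) / s := by
  have h1 : J * (Jt / J) ^ (s / t) ≤ Js := by
    refine le_trans (le_of_eq ?_) h
    rw [Real.div_rpow hJt.le hJ.le, Real.rpow_sub hJ, Real.rpow_one]
    ring
  have h2 : (Jt / J) ^ (s / t) = Real.exp (Real.log (Jt / J) * (s / t)) :=
    Real.rpow_def_of_pos (div_pos hJt hJ) _
  have h3 := Real.add_one_le_exp (Real.log (Jt / J) * (s / t))
  rw [← h2] at h3
  rw [le_div_iff₀ hs]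
  have h4 := (mul_le_mul_of_nonneg_left h3 hJ.le).trans h1
  have h5 : Real.log (Jt / J) * J / t * s = J * (Real.log (Jt / J) * (s / t)) := by ring
  rw [h5]; linarith

/-! ### Bounds for Lipschitz square roots with bounded support -/

/-- With `a = r²/(2s)`, Cauchy–Schwarz gives `(W + Lr)² ≤ (1 + a)(W² + 2sL²)`, and `(1 + a)e^{-a} ≤
1`. This is why square roots are taken: the increment is linear in `s`, uniformly in `W`. -/
theorem sq_mul_exp_le {W L r s : ℝ} (hs : 0 < s) :
    (W + L * r) ^ 2 * Real.exp (-(r ^ 2 / (2 * s))) ≤ W ^ 2 + 2 * s * L ^ 2 := by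
  set a := r ^ 2 / (2 * s) with ha
  have ha0 : 0 ≤ a := by positivity
  have hr : r ^ 2 = 2 * s * a := by rw [ha]; field_simp
  have h1 : (W + L * r) ^ 2 ≤ (1 + a) * (W ^ 2 + 2 * s * L ^ 2) := by
    have h2 : 0 ≤ (r * W - 2 * s * L) ^ 2 / (2 * s) := by positivity
    have h3 : (r * W - 2 * s * L) ^ 2 / (2 * s) = a * W ^ 2 - 2 * (r * W * L) + 2 * s * L ^ 2 := by
      rw [ha]; field_simp; ring
    nlinarith
  have h4 : (1 + a) * Real.exp (-a) ≤ 1 := by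
    rw [Real.exp_neg, ← div_eq_mul_inv, div_le_one (Real.exp_pos _), add_comm]
    exact Real.add_one_le_exp a
  have h5 : 0 ≤ W ^ 2 + 2 * s * L ^ 2 := by positivity
  calc _ ≤ (1 + a) * (W ^ 2 + 2 * s * L ^ 2) * Real.exp (-a) := by gcongr
    _ = (1 + a) * Real.exp (-a) * (W ^ 2 + 2 * s * L ^ 2) := by ring
    _ ≤ 1 * (W ^ 2 + 2 * s * L ^ 2) := by gcongr
    _ = _ := one_mul _

theorem hopfLax_sq_le {W : Rn n → ℝ} (hW0 : ∀ x, 0 ≤ W x) {L s : ℝ} (hs : 0 < s)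
    (hL : ∀ x y, W (x - y) ≤ W x + L * ‖T y‖) (x : Rn n) :
    hopfLax T s (fun z => ENNReal.ofReal (W z ^ 2)) x ≤
      ENNReal.ofReal (W x ^ 2) + ENNReal.ofReal (s * (2 * L ^ 2)) := by
  refine iSup_le fun y => ?_
  rw [← ENNReal.ofReal_mul (by positivity), ← ENNReal.ofReal_add (by positivity) (by positivity)]
  refine ENNReal.ofReal_le_ofReal ?_
  refine le_trans (mul_le_mul_of_nonneg_right (pow_le_pow_left₀ (hW0 _) (hL x y) 2)
    (Real.exp_pos _).le) ((sq_mul_exp_le hs).trans (le_of_eq (by ring)))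

/-- Follows from `e^{1/s - 1} ≥ 1/s`; the bound `c ≥ 2` makes the coefficient `c/2` of `1/s - 1` at
least 1. -/
theorem exp_div_le_mul_exp {c s : ℝ} (hc : 2 ≤ c) (hs : 0 < s) (hs1 : s ≤ 1) :
    Real.exp (-(c / (2 * s))) ≤ s * Real.exp (-(c / (2 * 1))) := by
  have h1 := Real.add_one_le_exp (1 / s - 1)
  have h2 : (1 : ℝ) ≤ 1 / s := by rw [le_div_iff₀ hs]; linarith
  have h3 : s * (1 / s) = 1 := by field_simp
  have h4 : 1 ≤ s * Real.exp (1 / s - 1) := by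
    calc (1 : ℝ) = s * (1 / s) := h3.symm
      _ ≤ s * Real.exp (1 / s - 1) := by gcongr; linarith
  have h5 : -(c / (2 * s)) = -(c / (2 * 1)) - c / 2 * (1 / s - 1) := by field_simp; ring
  have h6 : 1 / s - 1 ≤ c / 2 * (1 / s - 1) := by nlinarith
  calc Real.exp (-(c / (2 * s))) = Real.exp (-(c / (2 * 1))) * Real.exp (-(c / 2 * (1 / s - 1))) := by
        rw [h5, ← Real.exp_add]; ring_nf
    _ ≤ Real.exp (-(c / (2 * 1))) * Real.exp (-(1 / s - 1)) := by gcongr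
    _ ≤ Real.exp (-(c / (2 * 1))) * s := by
        gcongr
        rw [Real.exp_neg, inv_le_iff_one_le_mul₀ (Real.exp_pos _)]
        linarith
    _ = _ := mul_comm _ _

/-- Far from the support only displacements with `‖T y‖² ≥ 2` contribute, and each of these gains a
factor `s` over time 1. The time-1 function is then an integrable majorant. -/
theorem hopfLax_le_mul_hopfLax_one {g : Rn n → ℝ≥0∞} {s : ℝ} (hs : 0 < s) (hs1 : s ≤ 1)
    {x : Rn n} (hx : ∀ y, ‖T y‖ ^ 2 < 2 → g (x - y) = 0) :
    hopfLax T s g x ≤ ENNReal.ofReal s * hopfLax T 1 g x := by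
  unfold hopfLax
  rw [ENNReal.mul_iSup]
  refine iSup_mono fun y => ?_
  by_cases hy : ‖T y‖ ^ 2 < 2
  · simp [hx y hy]
  · rw [mul_left_comm, ← ENNReal.ofReal_mul hs.le]
    gcongr
    exact exp_div_le_mul_exp (not_lt.1 hy) hs hs1

theorem norm_le_of_sq_lt_two {y : Rn n} (hy : ‖T y‖ ^ 2 < 2) :
    ‖y‖ ≤ 2 * ‖(T.symm : Rn n →L[ℝ] Rn n)‖ := by
  have h1 : ‖y‖ ≤ ‖(T.symm : Rn n →L[ℝ] Rn n)‖ * ‖T y‖ := by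
    have := (T.symm : Rn n →L[ℝ] Rn n).le_opNorm (T y)
    simpa using this
  have h2 : ‖T y‖ ≤ 2 := by nlinarith [norm_nonneg (T y)]
  nlinarith [norm_nonneg (T.symm : Rn n →L[ℝ] Rn n)]

/-- An integrable dominating function for the difference quotients. -/
theorem hopfLax_sub_div_le {W : Rn n → ℝ} (hW0 : ∀ x, 0 ≤ W x) {L R s : ℝ} (hs : 0 < s)
    (hs1 : s ≤ 1) (hL : ∀ x y, W (x - y) ≤ W x + L * ‖T y‖) (hR : ∀ x, R < ‖x‖ → W x = 0)
    (x : Rn n) :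
    (hopfLax T s (fun z => ENNReal.ofReal (W z ^ 2)) x - ENNReal.ofReal (W x ^ 2)) /
        ENNReal.ofReal s ≤
      (Metric.closedBall (0 : Rn n) (R + 2 * ‖(T.symm : Rn n →L[ℝ] Rn n)‖)).indicator
        (fun _ => ENNReal.ofReal (2 * L ^ 2)) x +
      hopfLax T 1 (fun z => ENNReal.ofReal (W z ^ 2)) x := by
  have hs' : ENNReal.ofReal s ≠ 0 := by simpa using hs
  by_cases hx : x ∈ Metric.closedBall (0 : Rn n) (R + 2 * ‖(T.symm : Rn n →L[ℝ] Rn n)‖)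
  · rw [Set.indicator_of_mem hx]
    refine le_add_right (ENNReal.div_le_of_le_mul ?_)
    rw [mul_comm, ← ENNReal.ofReal_mul hs.le, tsub_le_iff_left]
    exact hopfLax_sq_le T hW0 hs hL x
  · refine le_add_left (ENNReal.div_le_of_le_mul (tsub_le_self.trans ?_))
    rw [mul_comm]
    refine hopfLax_le_mul_hopfLax_one T hs hs1 fun y hy => ?_
    have h1 := norm_le_of_sq_lt_two T hy
    have h2 : R < ‖x - y‖ := by
      have h3 := norm_sub_norm_le x y
      simp only [Metric.mem_closedBall, dist_zero_right, not_le] at hx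
      linarith
    simp [hR _ h2]

/-- Log-concavity in time bounds the logarithmic quotient at `t` by the integrated difference
quotient at each `s k < t`; reverse Fatou passes to the limit inside the integral. -/
theorem ofReal_log_div_le {W : Rn n → ℝ} (hWc : Continuous W) (hW0 : ∀ x, 0 ≤ W x) {L R t : ℝ}
    (hL : ∀ x y, W (x - y) ≤ W x + L * ‖T y‖) (hR : ∀ x, R < ‖x‖ → W x = 0)
    (hlc : ∀ a b : ℝ, 0 < a → 0 < b → a + b = 1 → ∀ x y,
      W x ^ a * W y ^ b ≤ W (a • x + b • y)) (ht : 0 < t)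
    (hJ0 : ∫⁻ x, ENNReal.ofReal (W x ^ 2) ≠ 0)
    (hJt : ∀ s, 0 < s → ∫⁻ x, hopfLax T s (fun z => ENNReal.ofReal (W z ^ 2)) x ≠ ⊤)
    {s : ℕ → ℝ} (hs : ∀ k, 0 < s k) (hs1 : ∀ k, s k ≤ 1) (hst : ∀ k, s k < t)
    {V : Rn n → ℝ≥0∞}
    (hV : ∀ᵐ x, limsup (fun k => (hopfLax T (s k) (fun z => ENNReal.ofReal (W z ^ 2)) x -
      ENNReal.ofReal (W x ^ 2)) / ENNReal.ofReal (s k)) atTop ≤ V x) :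
    ENNReal.ofReal (Real.log ((∫⁻ x, hopfLax T t (fun z => ENNReal.ofReal (W z ^ 2)) x).toReal /
      (∫⁻ x, ENNReal.ofReal (W x ^ 2)).toReal) * (∫⁻ x, ENNReal.ofReal (W x ^ 2)).toReal / t) ≤
      ∫⁻ x, V x := by
  set g : Rn n → ℝ≥0∞ := fun z => ENNReal.ofReal (W z ^ 2) with hg
  have hgc : Continuous g := ENNReal.continuous_ofReal.comp (hWc.pow 2)
  have hle : ∀ r, ∫⁻ x, g x ≤ ∫⁻ x, hopfLax T r g x := fun r =>
    lintegral_mono fun x => le_hopfLax T r g x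
  have hJtop : ∫⁻ x, g x ≠ ⊤ := ne_top_of_le_ne_top (hJt 1 one_pos) (hle 1)
  have hlcg : ∀ a b : ℝ, 0 < a → 0 < b → a + b = 1 → ∀ x y, g x ^ a * g y ^ b ≤ g (a • x + b • y) := by
    intro a b ha hb hab x y
    simp only [hg]
    rw [ENNReal.ofReal_rpow_of_nonneg (by positivity) ha.le,
      ENNReal.ofReal_rpow_of_nonneg (by positivity) hb.le, ← ENNReal.ofReal_mul (by positivity)]
    refine ENNReal.ofReal_le_ofReal ?_
    have h1 := pow_le_pow_left₀ (mul_nonneg (Real.rpow_nonneg (hW0 x) a)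
      (Real.rpow_nonneg (hW0 y) b)) (hlc a b ha hb hab x y) 2
    refine le_trans (le_of_eq ?_) h1
    rw [mul_pow, ← Real.rpow_natCast, ← Real.rpow_natCast, ← Real.rpow_natCast, ← Real.rpow_natCast,
      ← Real.rpow_mul (hW0 x), ← Real.rpow_mul (hW0 y), ← Real.rpow_mul (hW0 x),
      ← Real.rpow_mul (hW0 y), mul_comm a, mul_comm b]
  have step : ∀ k, ENNReal.ofReal (Real.log ((∫⁻ x, hopfLax T t g x).toReal /
      (∫⁻ x, g x).toReal) * (∫⁻ x, g x).toReal / t) ≤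
      ∫⁻ x, (hopfLax T (s k) g x - g x) / ENNReal.ofReal (s k) := by
    intro k
    have hsk : 0 < s k / t := div_pos (hs k) ht
    have hsk1 : s k / t < 1 := (div_lt_one ht).2 (hst k)
    have pl := lintegral_rpow_mul_hopfLax_rpow_le T ht (sub_pos.2 hsk1) hsk (by ring) hgc
      (hlcg _ _ (sub_pos.2 hsk1) hsk (by ring))
    rw [div_mul_cancel₀ _ ht.ne'] at pl
    have pl' := ENNReal.toReal_mono (hJt _ (hs k)) pl
    rw [ENNReal.toReal_mul, ← ENNReal.toReal_rpow, ← ENNReal.toReal_rpow] at pl'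
    have hJpos := ENNReal.toReal_pos hJ0 hJtop
    have hJtpos : 0 < (∫⁻ x, hopfLax T t g x).toReal :=
      hJpos.trans_le (ENNReal.toReal_mono (hJt _ ht) (hle t))
    have h1 := log_div_le_of_rpow hJpos hJtpos (hs k) pl'
    refine (ENNReal.ofReal_le_ofReal h1).trans (le_of_eq ?_)
    simp_rw [div_eq_mul_inv]
    have hm : Measurable fun x => hopfLax T (s k) g x - g x :=
      (measurable_hopfLax T _ hgc).sub hgc.measurable
    rw [lintegral_mul_const _ hm,
      lintegral_sub hgc.measurable hJtop (ae_of_all _ fun x => le_hopfLax T _ g x),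
      ← ENNReal.toReal_sub_of_le (hle _) (hJt _ (hs k)), ENNReal.ofReal_mul ENNReal.toReal_nonneg,
      ENNReal.ofReal_toReal (ENNReal.sub_ne_top (hJt _ (hs k))), ENNReal.ofReal_inv_of_pos (hs k)]
  calc _ ≤ limsup (fun k => ∫⁻ x, (hopfLax T (s k) g x - g x) / ENNReal.ofReal (s k)) atTop :=
        le_limsup_of_frequently_le (Frequently.of_forall step)
    _ ≤ ∫⁻ x, limsup (fun k => (hopfLax T (s k) g x - g x) / ENNReal.ofReal (s k)) atTop := by
        refine limsup_lintegral_le _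
          (fun k => ((measurable_hopfLax T _ hgc).sub hgc.measurable).div_const _)
          (fun k => ae_of_all _ (hopfLax_sub_div_le T hW0 (hs k) (hs1 k) hL hR)) ?_
        rw [lintegral_add_right _ (measurable_hopfLax T _ hgc),
          lintegral_indicator Metric.isClosed_closedBall.measurableSet, setLIntegral_const]
        exact ENNReal.add_ne_top.2 ⟨ENNReal.mul_ne_top ENNReal.ofReal_ne_top
          measure_closedBall_lt_top.ne, hJt 1 one_pos⟩
    _ ≤ ∫⁻ x, V x := lintegral_mono_ae hV

/-! ### Smooth convex potentials -/

/-- Convex functions of class `C²₊` with at least linear growth. -/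
structure IsPotential {n : ℕ} (u : Rn n → ℝ) : Prop where
  isC2Plus : IsC2Plus u
  convexOn : ConvexOn ℝ Set.univ u
  growth : ∃ C, ∀ x, ‖x‖ - C ≤ u x

/-- The inverse of the adjoint of `T`. -/
noncomputable def invAdjoint (T : Rn n ≃L[ℝ] Rn n) : Rn n →L[ℝ] Rn n :=
  ContinuousLinearMap.adjoint (T.symm : Rn n →L[ℝ] Rn n)

theorem inner_eq_inner_invAdjoint (p y : Rn n) : inner ℝ p y = inner ℝ (invAdjoint T p) (T y) := by
  rw [invAdjoint, ContinuousLinearMap.adjoint_inner_left]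
  simp

/-- Completing the square; equality holds at `y = s T⁻¹T⁻*p`. -/
theorem inner_sub_le (p y : Rn n) {s : ℝ} (hs : 0 < s) :
    inner ℝ p y - ‖T y‖ ^ 2 / (2 * s) ≤ s * (‖invAdjoint T p‖ ^ 2 / 2) := by
  rw [inner_eq_inner_invAdjoint T]
  have h1 := real_inner_le_norm (invAdjoint T p) (T y)
  have h2 : 0 ≤ (s * ‖invAdjoint T p‖ - ‖T y‖) ^ 2 / (2 * s) := by positivity
  have h3 : (s * ‖invAdjoint T p‖ - ‖T y‖) ^ 2 / (2 * s) =
      s * (‖invAdjoint T p‖ ^ 2 / 2) - ‖invAdjoint T p‖ * ‖T y‖ + ‖T y‖ ^ 2 / (2 * s) := by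
    field_simp; ring
  linarith

theorem integrable_exp_neg_norm : Integrable fun x : Rn n => Real.exp (-‖x‖) := by
  have h1 := integrable_one_add_norm (μ := (volume : Measure (Rn n))) (r := (n + 1 : ℕ))
    (by simp)
  obtain ⟨C, hC⟩ : ∃ C : ℝ, ∀ r : ℝ, 0 ≤ r → (1 + r) ^ (n + 1) ≤ C * Real.exp r := by
    refine ⟨(n + 1).factorial * Real.exp 1, fun r hr => ?_⟩
    have h2 := Real.pow_div_factorial_le_exp (1 + r) (by positivity) (n + 1)
    rw [div_le_iff₀ (by positivity), Real.exp_add] at h2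
    linarith
  refine (h1.const_mul C).mono' (by fun_prop) (ae_of_all _ fun x => ?_)
  rw [Real.norm_of_nonneg (Real.exp_pos _).le, Real.rpow_neg (by positivity), Real.rpow_natCast,
    Real.exp_neg, ← div_eq_mul_inv, inv_eq_one_div, div_le_div_iff₀ (Real.exp_pos _) (by positivity)]
  simpa using hC ‖x‖ (norm_nonneg _)

/-- Linear growth of `u` survives infimal convolution with a quadratic, with a worse constant, so
all masses `J(f ⊕ t·γ_T)` are finite. -/
theorem hopfLax_exp_neg_le {u : Rn n → ℝ} {C : ℝ} (hC : ∀ x, ‖x‖ - C ≤ u x) {t : ℝ} (ht : 0 < t) :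
    ∃ D : ℝ, ∀ x, hopfLax T t (fun z => ENNReal.ofReal (Real.exp (-u z))) x ≤
      ENNReal.ofReal (D * Real.exp (-‖x‖)) := by
  set c := ‖(T.symm : Rn n →L[ℝ] Rn n)‖
  refine ⟨Real.exp (C + t * c ^ 2 / 2), fun x => iSup_le fun y => ?_⟩
  rw [← ENNReal.ofReal_mul (Real.exp_pos _).le, ← Real.exp_add, ← Real.exp_add]
  refine ENNReal.ofReal_le_ofReal (Real.exp_le_exp.2 ?_)
  have h1 : ‖y‖ ≤ c * ‖T y‖ := by simpa using (T.symm : Rn n →L[ℝ] Rn n).le_opNorm (T y)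
  have h2 := hC (x - y)
  have h3 := norm_sub_norm_le x y
  have h4 : 0 ≤ (‖T y‖ - t * c) ^ 2 / (2 * t) := by positivity
  have h5 : (‖T y‖ - t * c) ^ 2 / (2 * t) = ‖T y‖ ^ 2 / (2 * t) - c * ‖T y‖ + t * c ^ 2 / 2 := by
    field_simp; ring
  linarith

namespace IsPotential

variable {u : Rn n → ℝ} (hu : IsPotential u)
include hu

theorem contDiff : ContDiff ℝ 2 u := hu.isC2Plus.1

theorem differentiable : Differentiable ℝ u := hu.contDiff.differentiable (by norm_num)

theorem continuous : Continuous u := hu.contDiff.continuous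

theorem continuous_gradient : Continuous (gradient u) :=
  (LinearIsometryEquiv.continuous _).comp (hu.contDiff.continuous_fderiv (by norm_num))

theorem hasDerivAt_line (x v : Rn n) : HasDerivAt (fun s : ℝ => u (x + s • v))
    (inner ℝ (gradient u x) v) 0 := by
  have h1 : HasDerivAt (fun s : ℝ => x + s • v) v 0 := by
    simpa using ((hasDerivAt_id (0 : ℝ)).smul_const v).const_add x
  have h2 : HasFDerivAt u (fderiv ℝ u x) (x + (0 : ℝ) • v) := by
    simpa using (hu.differentiable x).hasFDerivAt
  rw [inner_gradient_left]
  exact h2.comp_hasDerivAt 0 h1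

theorem add_inner_le (x v : Rn n) : u x + inner ℝ (gradient u x) v ≤ u (x + v) := by
  have hc : ConvexOn ℝ Set.univ fun s : ℝ => u (x + s • v) := by
    refine ⟨convex_univ, fun s _ t _ a b ha hb hab => ?_⟩
    have := hu.convexOn.2 (Set.mem_univ (x + s • v)) (Set.mem_univ (x + t • v)) ha hb hab
    obtain rfl : b = 1 - a := by linarith
    have e : x + (a * s + (1 - a) * t) • v = a • (x + s • v) + (1 - a) • (x + t • v) := by module
    simpa only [e, smul_eq_mul] using this
  have := hc.le_slope_of_hasDerivAt (Set.mem_univ 0) (Set.mem_univ 1) one_pos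
    (hu.hasDerivAt_line x v)
  simp only [slope_def_field, one_smul, zero_smul, add_zero, sub_zero, div_one] at this
  linarith

theorem continuous_ofReal_exp_neg : Continuous fun z => ENNReal.ofReal (Real.exp (-u z)) := by
  have := hu.continuous
  exact ENNReal.continuous_ofReal.comp (by fun_prop)

theorem lintegral_hopfLax_ne_top {t : ℝ} (ht : 0 < t) :
    ∫⁻ x, hopfLax T t (fun z => ENNReal.ofReal (Real.exp (-u z))) x ≠ ⊤ := by
  obtain ⟨C, hC⟩ := hu.growth
  obtain ⟨D, hD⟩ := hopfLax_exp_neg_le T hC ht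
  refine ne_top_of_le_ne_top ?_ (lintegral_mono hD)
  exact ((integrable_exp_neg_norm.const_mul D).lintegral_lt_top).ne

theorem integrable_exp_neg : Integrable fun x => Real.exp (-u x) := by
  obtain ⟨C, hC⟩ := hu.growth
  have := hu.continuous
  refine (integrable_exp_neg_norm.const_mul (Real.exp C)).mono' (by fun_prop)
    (ae_of_all _ fun x => ?_)
  rw [Real.norm_of_nonneg (Real.exp_pos _).le, ← Real.exp_add]
  exact Real.exp_le_exp.2 (by linarith [hC x])

theorem integral_exp_neg_pos : 0 < ∫ x, Real.exp (-u x) :=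
  integral_exp_pos hu.integrable_exp_neg

/-! ### The truncated square root -/

omit hu in
/-- The truncation `(e^{-u/2} - ε)₊`. -/
noncomputable def _root_.LogConcave.truncSqrt (u : Rn n → ℝ) (ε : ℝ) (x : Rn n) : ℝ :=
  max (Real.exp (-(u x / 2)) - ε) 0

omit hu in
theorem _root_.LogConcave.truncSqrt_nonneg (u : Rn n → ℝ) (ε : ℝ) (x : Rn n) :
    0 ≤ truncSqrt u ε x := le_max_right _ _

theorem continuous_truncSqrt (ε : ℝ) : Continuous (truncSqrt u ε) := by
  have := hu.continuous
  unfold truncSqrt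
  fun_prop

omit hu in
theorem _root_.LogConcave.truncSqrt_sq_le {ε : ℝ} (hε : 0 ≤ ε) (x : Rn n) :
    truncSqrt u ε x ^ 2 ≤ Real.exp (-u x) := by
  have h1 : Real.exp (-u x) = Real.exp (-(u x / 2)) ^ 2 := by
    rw [← Real.exp_nat_mul]; congr 1; push_cast; ring
  rw [h1]
  refine pow_le_pow_left₀ (truncSqrt_nonneg _ _ _) (max_le ?_ (Real.exp_pos _).le) 2
  linarith

/-- For `p, q > ε` the weighted geometric mean is superadditive: `(p-ε)^a (q-ε)^b + ε^a ε^b ≤ p^a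
q^b`, by AM–GM after dividing by the right side. The subtracted `ε` therefore preserves
log-concavity. -/
theorem rpow_mul_truncSqrt_rpow_le {ε a b : ℝ} (hε : 0 < ε) (ha : 0 < a) (hb : 0 < b)
    (hab : a + b = 1) (x y : Rn n) :
    truncSqrt u ε x ^ a * truncSqrt u ε y ^ b ≤ truncSqrt u ε (a • x + b • y) := by
  rcases le_or_gt (Real.exp (-(u x / 2))) ε with hx | hx
  · rw [show truncSqrt u ε x = 0 from max_eq_right (by linarith), Real.zero_rpow ha.ne', zero_mul]
    exact truncSqrt_nonneg _ _ _
  rcases le_or_gt (Real.exp (-(u y / 2))) ε with hy | hy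
  · rw [show truncSqrt u ε y = 0 from max_eq_right (by linarith), Real.zero_rpow hb.ne', mul_zero]
    exact truncSqrt_nonneg _ _ _
  set p := Real.exp (-(u x / 2)) with hp
  set q := Real.exp (-(u y / 2)) with hq
  have hp0 : 0 < p := Real.exp_pos _
  have hq0 : 0 < q := Real.exp_pos _
  rw [show truncSqrt u ε x = p - ε from max_eq_left (by linarith),
    show truncSqrt u ε y = q - ε from max_eq_left (by linarith)]
  refine le_trans ?_ (le_max_left _ _)
  have h1 : p ^ a * q ^ b ≤ Real.exp (-(u (a • x + b • y) / 2)) := by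
    rw [hp, hq, ← Real.exp_mul, ← Real.exp_mul, ← Real.exp_add]
    refine Real.exp_le_exp.2 ?_
    have := hu.convexOn.2 (Set.mem_univ x) (Set.mem_univ y) ha.le hb.le hab
    simp only [smul_eq_mul] at this
    linarith
  have h2 := Real.geom_mean_le_arith_mean2_weighted ha.le hb.le
    (div_nonneg (sub_pos.2 hx).le hp0.le) (div_nonneg (sub_pos.2 hy).le hq0.le) hab
  have h3 := Real.geom_mean_le_arith_mean2_weighted ha.le hb.le
    (div_nonneg hε.le hp0.le) (div_nonneg hε.le hq0.le) hab
  rw [Real.div_rpow (sub_pos.2 hx).le hp0.le, Real.div_rpow (sub_pos.2 hy).le hq0.le] at h2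
  rw [Real.div_rpow hε.le hp0.le, Real.div_rpow hε.le hq0.le] at h3
  have hP : 0 < p ^ a := Real.rpow_pos_of_pos hp0 _
  have hQ : 0 < q ^ b := Real.rpow_pos_of_pos hq0 _
  have h4 : ε ^ a * ε ^ b = ε := by rw [← Real.rpow_add hε, hab, Real.rpow_one]
  have h5 : (p - ε) ^ a / p ^ a * ((q - ε) ^ b / q ^ b) + ε ^ a / p ^ a * (ε ^ b / q ^ b) ≤ 1 := by
    have e : a * ((p - ε) / p) + b * ((q - ε) / q) + (a * (ε / p) + b * (ε / q)) = 1 := by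
      rw [← hab]; field_simp; ring
    linarith
  rw [div_mul_div_comm, div_mul_div_comm, h4, ← add_div, div_le_one (mul_pos hP hQ)] at h5
  linarith

theorem exists_radius {ε : ℝ} (hε : 0 < ε) : ∃ R, ∀ x, R < ‖x‖ → truncSqrt u ε x = 0 := by
  obtain ⟨C, hC⟩ := hu.growth
  refine ⟨C - 2 * Real.log ε, fun x hx => max_eq_right ?_⟩
  have h1 : -(u x / 2) ≤ Real.log ε := by linarith [hC x]
  have := Real.exp_le_exp.2 h1
  rw [Real.exp_log hε] at this
  linarith

theorem exists_bound : ∃ M, ∀ x, Real.exp (-(u x / 2)) ≤ M := by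
  obtain ⟨C, hC⟩ := hu.growth
  exact ⟨Real.exp (C / 2), fun x => Real.exp_le_exp.2 (by linarith [hC x, norm_nonneg x])⟩

/-- Where both points lie in the ball of radius `R + 1`, the `C¹` bound applies. If `x` is outside
it and `x - y` is in the ball of radius `R`, then `‖y‖ ≥ 1` and the global bound `M` suffices. -/
theorem exists_lipschitz {ε : ℝ} (hε : 0 < ε) : ∃ L, ∀ x y,
    truncSqrt u ε (x - y) ≤ truncSqrt u ε x + L * ‖T y‖ := by
  obtain ⟨R, hR⟩ := hu.exists_radius hε
  obtain ⟨M, hM⟩ := hu.exists_bound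
  have hM0 : 0 ≤ M := (Real.exp_pos _).le.trans (hM 0)
  have hd : ContDiff ℝ 2 fun x => Real.exp (-(u x / 2)) := (hu.contDiff.div_const 2).neg.exp
  obtain ⟨K, hK⟩ := (isCompact_closedBall (0 : Rn n) (R + 1)).exists_bound_of_continuousOn
    (hd.continuous_fderiv (by norm_num)).continuousOn
  have hlip := (convex_closedBall (0 : Rn n) (R + 1)).lipschitzOnWith_of_nnnorm_fderiv_le
    (f := fun x => Real.exp (-(u x / 2))) (C := K.toNNReal)
    (fun x _ => hd.differentiable (by norm_num) x)
    (fun x hx => by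
      rw [← NNReal.coe_le_coe, coe_nnnorm]
      exact (hK x hx).trans (Real.le_coe_toNNReal K))
  have key : ∀ x y, truncSqrt u ε (x - y) ≤ truncSqrt u ε x + (K.toNNReal + M) * ‖y‖ := by
    intro x y
    have hx0 := truncSqrt_nonneg u ε x
    have hy0 := norm_nonneg y
    have hKn : (0 : ℝ) ≤ K.toNNReal := NNReal.coe_nonneg _
    rcases lt_or_ge R ‖x - y‖ with h | h
    · rw [hR _ h]; positivity
    have hmem : x - y ∈ Metric.closedBall (0 : Rn n) (R + 1) := by simp; linarith
    by_cases hx : x ∈ Metric.closedBall (0 : Rn n) (R + 1)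
    · have h1 := hlip.dist_le_mul _ hmem _ hx
      rw [Real.dist_eq, dist_eq_norm] at h1
      have h2 : ‖x - y - x‖ = ‖y‖ := by rw [sub_sub_cancel_left, norm_neg]
      rw [h2] at h1
      have h3 := (le_abs_self _).trans h1
      have h4 : Real.exp (-(u x / 2)) - ε ≤ truncSqrt u ε x := le_max_left _ _
      have h5 : 0 ≤ M * ‖y‖ := by positivity
      refine max_le ?_ (by positivity)
      rw [add_mul]; linarith
    · simp only [Metric.mem_closedBall, dist_zero_right, not_le] at hx
      have h1 : 1 ≤ ‖y‖ := by
        have := norm_sub_norm_le x (x - y)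
        rw [sub_sub_cancel] at this
        linarith
      have h2 : truncSqrt u ε (x - y) ≤ M := max_le (by linarith [hM (x - y)]) hM0
      nlinarith [mul_nonneg hKn hy0]
  refine ⟨(K.toNNReal + M) * ‖(T.symm : Rn n →L[ℝ] Rn n)‖, fun x y => (key x y).trans ?_⟩
  have h1 : ‖y‖ ≤ ‖(T.symm : Rn n →L[ℝ] Rn n)‖ * ‖T y‖ := by
    simpa using (T.symm : Rn n →L[ℝ] Rn n).le_opNorm (T y)
  rw [mul_assoc]
  have : (0 : ℝ) ≤ K.toNNReal + M := by positivity
  gcongr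

/-- At points where `e^{-u/2} > ε`, the truncation lies below an exponential. -/
theorem truncSqrt_sub_le {ε : ℝ} (hε : 0 < ε) {x : Rn n} (hx : ε < Real.exp (-(u x / 2)))
    (y : Rn n) : truncSqrt u ε (x - y) ≤ truncSqrt u ε x *
      Real.exp (inner ℝ ((Real.exp (-(u x / 2)) / (Real.exp (-(u x / 2)) - ε)) • gradient u x) y
        / 2) := by
  set w := Real.exp (-(u x / 2)) with hw
  have hw0 : 0 < w := Real.exp_pos _
  have hd : 0 < w - ε := sub_pos.2 hx
  rw [show truncSqrt u ε x = w - ε from max_eq_left hd.le, inner_smul_left]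
  simp only [conj_trivial]
  set i := inner ℝ (gradient u x) y with hi
  refine max_le ?_ (by positivity)
  have h1 : Real.exp (-(u (x - y) / 2)) ≤ w * Real.exp (i / 2) := by
    rw [hw, ← Real.exp_add]
    refine Real.exp_le_exp.2 ?_
    have := hu.add_inner_le x (-y)
    rw [inner_neg_right, ← sub_eq_add_neg x y] at this
    linarith
  -- Convexity of `exp` with weights `(w-ε)/w` and `ε/w` at `w/(w-ε) · i/2` and `0`; multiplied by
  -- `w`, it absorbs the subtracted `ε`.
  have h2 := convexOn_exp.2 (Set.mem_univ (w / (w - ε) * i / 2)) (Set.mem_univ (0 : ℝ))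
    (div_nonneg hd.le hw0.le) (div_nonneg hε.le hw0.le) (by field_simp; ring)
  simp only [smul_eq_mul, mul_zero, add_zero, Real.exp_zero, mul_one] at h2
  rw [show (w - ε) / w * (w / (w - ε) * i / 2) = i / 2 by field_simp] at h2
  have h3 := mul_le_mul_of_nonneg_left h2 hw0.le
  rw [mul_add, ← mul_assoc, mul_div_cancel₀ _ hw0.ne', mul_div_cancel₀ _ hw0.ne'] at h3
  linarith

theorem hopfLax_truncSqrt_le {ε s : ℝ} (hε : 0 < ε) (hs : 0 < s) {x : Rn n}
    (hx : ε < Real.exp (-(u x / 2))) :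
    hopfLax T s (fun z => ENNReal.ofReal (truncSqrt u ε z ^ 2)) x ≤
      ENNReal.ofReal (truncSqrt u ε x ^ 2 * Real.exp (s * (‖invAdjoint T
        ((Real.exp (-(u x / 2)) / (Real.exp (-(u x / 2)) - ε)) • gradient u x)‖ ^ 2 / 2))) := by
  refine iSup_le fun y => ?_
  rw [← ENNReal.ofReal_mul (by positivity)]
  refine ENNReal.ofReal_le_ofReal ?_
  set p := (Real.exp (-(u x / 2)) / (Real.exp (-(u x / 2)) - ε)) • gradient u x
  have h1 := pow_le_pow_left₀ (truncSqrt_nonneg _ _ _) (hu.truncSqrt_sub_le hε hx y) 2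
  have h2 := inner_sub_le T p y hs
  calc _ ≤ (truncSqrt u ε x * Real.exp (inner ℝ p y / 2)) ^ 2 *
        Real.exp (-(‖T y‖ ^ 2 / (2 * s))) := by gcongr
    _ = truncSqrt u ε x ^ 2 * Real.exp (inner ℝ p y - ‖T y‖ ^ 2 / (2 * s)) := by
        rw [mul_pow, ← Real.exp_nat_mul, mul_assoc, ← Real.exp_add]
        congr 2
        push_cast
        ring
    _ ≤ _ := by gcongr

omit hu in
theorem _root_.LogConcave.tendsto_exp_mul_sub_one_div {s : ℕ → ℝ} (hs : ∀ k, 0 < s k)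
    (hs0 : Tendsto s atTop (𝓝 0)) (q : ℝ) :
    Tendsto (fun k => (Real.exp (s k * q) - 1) / s k) atTop (𝓝 q) := by
  have h1 : HasDerivAt (fun t : ℝ => Real.exp (t * q)) q 0 := by
    simpa using ((hasDerivAt_id (0 : ℝ)).mul_const q).exp
  have h2 := h1.tendsto_slope.comp (tendsto_nhdsWithin_iff.2
    ⟨hs0, Eventually.of_forall fun k => (hs k).ne'⟩)
  refine h2.congr fun k => ?_
  simp [slope_def_field]

/-- The truncation steepens the logarithmic slope by `w/(w-ε)` and lowers the value `w` to `w-ε`; in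
the quadratic expression these cancel, so the bound does not depend on `ε`. -/
theorem limsup_le_of_lt {ε : ℝ} (hε : 0 < ε) {x : Rn n} (hx : ε < Real.exp (-(u x / 2)))
    {s : ℕ → ℝ} (hs : ∀ k, 0 < s k) (hs0 : Tendsto s atTop (𝓝 0)) :
    limsup (fun k => (hopfLax T (s k) (fun z => ENNReal.ofReal (truncSqrt u ε z ^ 2)) x -
      ENNReal.ofReal (truncSqrt u ε x ^ 2)) / ENNReal.ofReal (s k)) atTop ≤
      ENNReal.ofReal (‖invAdjoint T (gradient u x)‖ ^ 2 / 2 * Real.exp (-u x)) := by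
  set w := Real.exp (-(u x / 2)) with hw
  set p := (w / (w - ε)) • gradient u x with hp
  set q := ‖invAdjoint T p‖ ^ 2 / 2 with hq
  have hd : 0 < w - ε := sub_pos.2 hx
  have hW : truncSqrt u ε x = w - ε := max_eq_left hd.le
  have hval : truncSqrt u ε x ^ 2 * q = ‖invAdjoint T (gradient u x)‖ ^ 2 / 2 * Real.exp (-u x) := by
    have h1 : Real.exp (-u x) = w ^ 2 := by
      rw [hw, ← Real.exp_nat_mul]; congr 1; push_cast; ring
    rw [h1, hW, hq, hp, map_smul, norm_smul, mul_pow, Real.norm_eq_abs, sq_abs]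
    field_simp
  have hlim : Tendsto (fun k => ENNReal.ofReal (truncSqrt u ε x ^ 2 *
      ((Real.exp (s k * q) - 1) / s k))) atTop (𝓝 (ENNReal.ofReal (truncSqrt u ε x ^ 2 * q))) :=
    (ENNReal.continuous_ofReal.tendsto _).comp ((tendsto_exp_mul_sub_one_div hs hs0 q).const_mul _)
  rw [← hval, ← hlim.limsup_eq]
  refine limsup_le_limsup (Eventually.of_forall fun k => ?_)
  have h1 := hu.hopfLax_truncSqrt_le T hε (hs k) hx
  refine ENNReal.div_le_of_le_mul ?_
  rw [← ENNReal.ofReal_mul' (hs k).le, tsub_le_iff_left,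
    ← ENNReal.ofReal_add (by positivity)]
  · refine h1.trans (ENNReal.ofReal_le_ofReal (le_of_eq ?_))
    rw [mul_assoc, div_mul_cancel₀ _ (hs k).ne']
    ring
  · have : 1 ≤ Real.exp (s k * q) := Real.one_le_exp (mul_nonneg (hs k).le (by positivity))
    have := (hs k).le
    rw [mul_assoc, div_mul_cancel₀ _ (hs k).ne']
    exact mul_nonneg (by positivity) (by linarith)

/-- The truncation vanishes near `x`, so only displacements with `‖T y‖ ≥ δ` matter, and there the
Gaussian factor is `O(s²)`. -/
theorem limsup_le_of_gt {ε : ℝ} (hε : 0 < ε) {x : Rn n} (hx : Real.exp (-(u x / 2)) < ε)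
    {s : ℕ → ℝ} (hs : ∀ k, 0 < s k) (hs0 : Tendsto s atTop (𝓝 0)) :
    limsup (fun k => (hopfLax T (s k) (fun z => ENNReal.ofReal (truncSqrt u ε z ^ 2)) x -
      ENNReal.ofReal (truncSqrt u ε x ^ 2)) / ENNReal.ofReal (s k)) atTop ≤ 0 := by
  obtain ⟨M, hM⟩ := hu.exists_bound
  have hc : Continuous fun v : Rn n => Real.exp (-(u (x - T.symm v) / 2)) := by
    have := hu.continuous
    fun_prop
  obtain ⟨δ, hδ, hδ'⟩ := Metric.eventually_nhds_iff.1 (hc.continuousAt.eventually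
    (Iio_mem_nhds (show Real.exp (-(u (x - T.symm 0) / 2)) < ε by simpa using hx)))
  have hz : ∀ y, ‖T y‖ < δ → truncSqrt u ε (x - y) = 0 := by
    intro y hy
    have := hδ' (y := T y) (by simpa using hy)
    simp only [ContinuousLinearEquiv.symm_apply_apply] at this
    exact max_eq_right (by linarith)
  have hb : ∀ y, truncSqrt u ε y ^ 2 ≤ M ^ 2 := fun y =>
    pow_le_pow_left₀ (truncSqrt_nonneg _ _ _) (max_le (by linarith [hM y])
      ((Real.exp_pos _).le.trans (hM y))) 2
  have hlim : Tendsto (fun k => ENNReal.ofReal (M ^ 2 * (8 / δ ^ 4) * s k)) atTop (𝓝 0) := by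
    have := (ENNReal.continuous_ofReal.tendsto _).comp (hs0.const_mul (M ^ 2 * (8 / δ ^ 4)))
    rwa [mul_zero, ENNReal.ofReal_zero] at this
  rw [← hlim.limsup_eq]
  refine limsup_le_limsup (Eventually.of_forall fun k => ?_)
  have hk := hs k
  refine ENNReal.div_le_of_le_mul (tsub_le_self.trans (iSup_le fun y => ?_))
  rw [← ENNReal.ofReal_mul (by positivity), ← ENNReal.ofReal_mul (by positivity)]
  refine ENNReal.ofReal_le_ofReal ?_
  rcases lt_or_ge ‖T y‖ δ with h | h
  · rw [hz y h]; simp; positivity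
  have h1 : Real.exp (-(‖T y‖ ^ 2 / (2 * s k))) ≤ 8 / δ ^ 4 * s k * s k := by
    calc _ ≤ Real.exp (-(δ ^ 2 / (2 * s k))) := by gcongr
      -- From `e^a ≥ a²/2` with `a = δ²/(2s)`, which produces the constant `8/δ⁴`.
      _ ≤ ((δ ^ 2 / (2 * s k)) ^ 2 / 2)⁻¹ := by
          rw [Real.exp_neg]
          have h2 : 0 ≤ δ ^ 2 / (2 * s k) := by positivity
          have := Real.quadratic_le_exp_of_nonneg h2
          gcongr
          linarith
      _ = 8 / δ ^ 4 * s k * s k := by field_simp; ring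
  calc _ ≤ M ^ 2 * (8 / δ ^ 4 * s k * s k) := by
        exact mul_le_mul (hb _) h1 (Real.exp_pos _).le (by positivity)
    _ = _ := by ring

end IsPotential

namespace IsPotential

variable {u : Rn n → ℝ} (hu : IsPotential u)
include hu

/-! ### The first variation -/

theorem lintegral_truncSqrt_ne_top {ε s : ℝ} (hε : 0 ≤ ε) (hs : 0 < s) :
    ∫⁻ x, hopfLax T s (fun z => ENNReal.ofReal (truncSqrt u ε z ^ 2)) x ≠ ⊤ :=
  ne_top_of_le_ne_top (hu.lintegral_hopfLax_ne_top T hs) (lintegral_mono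
    (hopfLax_mono T s fun x => ENNReal.ofReal_le_ofReal (truncSqrt_sq_le hε x)))

theorem log_div_truncSqrt_le {ε t : ℝ} (hε : 0 < ε) (ht : 0 < t)
    (hnull : volume {x | Real.exp (-(u x / 2)) = ε} = 0)
    (hJ : ∫⁻ x, ENNReal.ofReal (truncSqrt u ε x ^ 2) ≠ 0)
    (hI : Integrable fun x => ‖invAdjoint T (gradient u x)‖ ^ 2 / 2 * Real.exp (-u x)) :
    Real.log ((∫⁻ x, hopfLax T t (fun z => ENNReal.ofReal (truncSqrt u ε z ^ 2)) x).toReal /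
      (∫⁻ x, ENNReal.ofReal (truncSqrt u ε x ^ 2)).toReal) *
      (∫⁻ x, ENNReal.ofReal (truncSqrt u ε x ^ 2)).toReal / t ≤
      ∫ x, ‖invAdjoint T (gradient u x)‖ ^ 2 / 2 * Real.exp (-u x) := by
  obtain ⟨L, hL⟩ := hu.exists_lipschitz T hε
  obtain ⟨R, hR⟩ := hu.exists_radius hε
  obtain ⟨s, -, hs, hs0⟩ := exists_seq_strictAnti_tendsto' (lt_min ht one_pos)
  have hI0 : 0 ≤ ∫ x, ‖invAdjoint T (gradient u x)‖ ^ 2 / 2 * Real.exp (-u x) :=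
    integral_nonneg fun x => by positivity
  refine (ENNReal.ofReal_le_ofReal_iff hI0).1 ?_
  rw [ofReal_integral_eq_lintegral_ofReal hI (ae_of_all _ fun x => by positivity)]
  refine ofReal_log_div_le T (hu.continuous_truncSqrt ε) (truncSqrt_nonneg u ε) hL hR
    (fun a b ha hb hab => hu.rpow_mul_truncSqrt_rpow_le hε ha hb hab) ht hJ
    (fun r hr => hu.lintegral_truncSqrt_ne_top T hε.le hr) (s := s) (fun k => (hs k).1)
    (fun k => (hs k).2.le.trans (min_le_right _ _))
    (fun k => (hs k).2.trans_le (min_le_left _ _)) ?_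
  have hae : ∀ᵐ x, Real.exp (-(u x / 2)) ≠ ε := by
    rw [ae_iff]
    simpa using hnull
  filter_upwards [hae] with x hx
  rcases lt_or_gt_of_ne hx with h | h
  · exact (hu.limsup_le_of_gt T hε h (fun k => (hs k).1) hs0).trans bot_le
  · exact hu.limsup_le_of_lt T hε h (fun k => (hs k).1) hs0

omit hu in
theorem _root_.LogConcave.truncSqrt_anti {ε δ : ℝ} (h : ε ≤ δ) (x : Rn n) :
    truncSqrt u δ x ≤ truncSqrt u ε x := max_le_max (by linarith) le_rfl

/-- The functional Minkowski-type inequality for the first variation. -/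
theorem log_div_le {t : ℝ} (ht : 0 < t)
    (hI : Integrable fun x => ‖invAdjoint T (gradient u x)‖ ^ 2 / 2 * Real.exp (-u x)) :
    Real.log ((∫⁻ x, hopfLax T t (fun z => ENNReal.ofReal (Real.exp (-u z))) x).toReal /
      (∫ x, Real.exp (-u x))) * (∫ x, Real.exp (-u x)) / t ≤
      ∫ x, ‖invAdjoint T (gradient u x)‖ ^ 2 / 2 * Real.exp (-u x) := by
  have hwm : Measurable fun x => Real.exp (-(u x / 2)) := by
    have := hu.continuous
    exact Continuous.measurable (by fun_prop)
  -- Only countably many level sets have positive measure, so `ε k ↓ 0` can avoid them; at points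
  -- with `e^{-u/2} = ε` neither pointwise bound applies.
  have hcount := Measure.countable_meas_level_set_pos (μ := (volume : Measure (Rn n))) hwm
  obtain ⟨ε, hanti, hmem, hlim⟩ := (hcount.dense_compl ℝ).exists_seq_strictAnti_tendsto 0
  have hε : ∀ k, 0 < ε k := fun k => (hmem k).1
  have hnull : ∀ k, volume {x | Real.exp (-(u x / 2)) = ε k} = 0 := fun k => by
    simpa using (hmem k).2
  set g : ℕ → Rn n → ℝ≥0∞ := fun k z => ENNReal.ofReal (truncSqrt u (ε k) z ^ 2) with hg
  have hgm : ∀ x, Monotone fun k => g k x := fun x k l hkl => ENNReal.ofReal_le_ofReal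
    (pow_le_pow_left₀ (truncSqrt_nonneg _ _ _) (truncSqrt_anti (hanti.antitone hkl) x) 2)
  have hgl : ∀ x, Tendsto (fun k => g k x) atTop (𝓝 (ENNReal.ofReal (Real.exp (-u x)))) := by
    intro x
    refine (ENNReal.continuous_ofReal.tendsto _).comp ?_
    have h1 : Real.exp (-u x) = max (Real.exp (-(u x / 2)) - 0) 0 ^ 2 := by
      rw [sub_zero, max_eq_left (Real.exp_pos _).le, ← Real.exp_nat_mul]
      congr 1
      push_cast
      ring
    rw [h1]
    exact ((hlim.const_sub _).max tendsto_const_nhds).pow 2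
  have hgc : ∀ k, Continuous (g k) := fun k =>
    ENNReal.continuous_ofReal.comp ((hu.continuous_truncSqrt _).pow 2)
  have hJ : Tendsto (fun k => ∫⁻ x, g k x) atTop
      (𝓝 (∫⁻ x, ENNReal.ofReal (Real.exp (-u x)))) :=
    lintegral_tendsto_of_tendsto_of_monotone (fun k => (hgc k).measurable.aemeasurable)
      (ae_of_all _ hgm) (ae_of_all _ hgl)
  have hQ : Tendsto (fun k => ∫⁻ x, hopfLax T t (g k) x) atTop
      (𝓝 (∫⁻ x, hopfLax T t (fun z => ENNReal.ofReal (Real.exp (-u z))) x)) := by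
    refine lintegral_tendsto_of_tendsto_of_monotone
      (fun k => (measurable_hopfLax T t (hgc k)).aemeasurable)
      (ae_of_all _ fun x k l hkl => hopfLax_mono T t (fun z => hgm z hkl) x)
      (ae_of_all _ fun x => ?_)
    have h1 : (fun z => ENNReal.ofReal (Real.exp (-u z))) = fun z => ⨆ k, g k z :=
      funext fun z => (iSup_eq_of_tendsto (hgm z) (hgl z)).symm
    rw [h1, hopfLax_iSup]
    exact tendsto_atTop_iSup fun k l hkl => hopfLax_mono T t (fun z => hgm z hkl) x
  have hJr : ∫⁻ x, ENNReal.ofReal (Real.exp (-u x)) = ENNReal.ofReal (∫ x, Real.exp (-u x)) :=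
    (ofReal_integral_eq_lintegral_ofReal hu.integrable_exp_neg
      (ae_of_all _ fun x => (Real.exp_pos _).le)).symm
  have hJpos := hu.integral_exp_neg_pos
  have hJ' : Tendsto (fun k => (∫⁻ x, g k x).toReal) atTop (𝓝 (∫ x, Real.exp (-u x))) := by
    rw [hJr] at hJ
    have := (ENNReal.tendsto_toReal ENNReal.ofReal_ne_top).comp hJ
    rwa [ENNReal.toReal_ofReal hJpos.le] at this
  have hQ' := (ENNReal.tendsto_toReal (hu.lintegral_hopfLax_ne_top T ht)).comp hQ
  have hQpos : 0 < (∫⁻ x, hopfLax T t (fun z => ENNReal.ofReal (Real.exp (-u z))) x).toReal := by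
    have h1 := ENNReal.toReal_mono (hu.lintegral_hopfLax_ne_top T ht) (lintegral_mono
      fun x => le_hopfLax T t (fun z => ENNReal.ofReal (Real.exp (-u z))) x)
    rw [hJr, ENNReal.toReal_ofReal hJpos.le] at h1
    linarith
  have hlim' := (((hQ'.div hJ' hJpos.ne').log (div_pos hQpos hJpos).ne').mul hJ').div_const t
  refine le_of_tendsto hlim' ?_
  have hpos : ∀ᶠ k in atTop, 0 < (∫⁻ x, g k x).toReal := hJ'.eventually (Ioi_mem_nhds hJpos)
  filter_upwards [hpos] with k hk
  exact hu.log_div_truncSqrt_le T (hε k) ht (hnull k)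
    (fun h => by simp only [hg] at hk; rw [h] at hk; simp at hk) hI

omit hu in
theorem _root_.LogConcave.hopfLax_sub_div_ge (u : Rn n → ℝ) (x : Rn n) {t : ℝ} (ht : 0 < t) :
    ENNReal.ofReal ((Real.exp (-(u (x + t • -(T.symm (invAdjoint T (gradient u x)))) +
      t * (‖invAdjoint T (gradient u x)‖ ^ 2 / 2))) - Real.exp (-u x)) / t) ≤
      (hopfLax T t (fun z => ENNReal.ofReal (Real.exp (-u z))) x -
        ENNReal.ofReal (Real.exp (-u x))) / ENNReal.ofReal t := by
  rw [ENNReal.ofReal_div_of_pos ht, ENNReal.ofReal_sub _ (Real.exp_pos _).le]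
  refine ENNReal.div_le_div_right (tsub_le_tsub_right ?_ _) _
  refine le_trans (le_of_eq ?_) (le_iSup _ (t • T.symm (invAdjoint T (gradient u x))))
  rw [← ENNReal.ofReal_mul (Real.exp_pos _).le, ← Real.exp_add, map_smul, norm_smul,
    T.apply_symm_apply, Real.norm_eq_abs, mul_pow, sq_abs, smul_neg, ← sub_eq_add_neg]
  congr 2
  field_simp
  ring

/-- Along the displacement optimal for the tangent plane the exponent has derivative `‖S‖² - ‖S‖²/2`
at `t = 0`. -/
theorem le_liminf (x : Rn n) :
    ENNReal.ofReal (‖invAdjoint T (gradient u x)‖ ^ 2 / 2 * Real.exp (-u x)) ≤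
      liminf (fun t : ℝ => (hopfLax T t (fun z => ENNReal.ofReal (Real.exp (-u z))) x -
        ENNReal.ofReal (Real.exp (-u x))) / ENNReal.ofReal t) (𝓝[>] 0) := by
  set S := invAdjoint T (gradient u x) with hS
  have h1 := hu.hasDerivAt_line x (-(T.symm S))
  have h2 : inner ℝ (gradient u x) (-(T.symm S)) = -‖S‖ ^ 2 := by
    rw [inner_neg_right, inner_eq_inner_invAdjoint T, T.apply_symm_apply, ← hS,
      real_inner_self_eq_norm_sq]
  rw [h2] at h1
  have h3 : HasDerivAt (fun t : ℝ => Real.exp (-(u (x + t • -(T.symm S)) + t * (‖S‖ ^ 2 / 2))))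
      (‖S‖ ^ 2 / 2 * Real.exp (-u x)) 0 := by
    convert! ((h1.add ((hasDerivAt_id (0 : ℝ)).mul_const (‖S‖ ^ 2 / 2))).neg).exp using 1
    simp
    ring
  have h4 : Tendsto (fun t : ℝ => (Real.exp (-(u (x + t • -(T.symm S)) + t * (‖S‖ ^ 2 / 2))) -
      Real.exp (-u x)) / t) (𝓝[>] 0) (𝓝 (‖S‖ ^ 2 / 2 * Real.exp (-u x))) := by
    refine (h3.tendsto_slope.mono_left (nhdsWithin_mono _ fun t ht => (ne_of_gt ht))).congr ?_
    intro t
    simp [slope_def_field]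
  have h5 := (ENNReal.continuous_ofReal.tendsto _).comp h4
  rw [← h5.liminf_eq]
  refine liminf_le_liminf ?_
  filter_upwards [self_mem_nhdsWithin] with t ht
  exact hopfLax_sub_div_ge T u x ht

/-- The first variation of the total mass in the direction of a Gaussian. -/
theorem tendsto_lintegral_hopfLax
    (hI : Integrable fun x => ‖invAdjoint T (gradient u x)‖ ^ 2 / 2 * Real.exp (-u x)) :
    Tendsto (fun t : ℝ =>
      ((∫⁻ x, hopfLax T t (fun z => ENNReal.ofReal (Real.exp (-u z))) x).toReal -
        ∫ x, Real.exp (-u x)) / t) (𝓝[>] 0)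
      (𝓝 (∫ x, ‖invAdjoint T (gradient u x)‖ ^ 2 / 2 * Real.exp (-u x))) := by
  set I := ∫ x, ‖invAdjoint T (gradient u x)‖ ^ 2 / 2 * Real.exp (-u x) with hIdef
  set J := ∫ x, Real.exp (-u x) with hJdef
  set F : Rn n → ℝ≥0∞ := fun z => ENNReal.ofReal (Real.exp (-u z)) with hF
  have hJpos : 0 < J := hu.integral_exp_neg_pos
  have hFc : Continuous F := hu.continuous_ofReal_exp_neg
  have hJr : ∫⁻ x, F x = ENNReal.ofReal J :=
    (ofReal_integral_eq_lintegral_ofReal hu.integrable_exp_neg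
      (ae_of_all _ fun x => (Real.exp_pos _).le)).symm
  have hge : ∀ t, 0 < t → J ≤ (∫⁻ x, hopfLax T t F x).toReal := fun t ht => by
    have h1 := ENNReal.toReal_mono (hu.lintegral_hopfLax_ne_top T ht) (lintegral_mono
      fun x => le_hopfLax T t F x)
    rwa [hJr, ENNReal.toReal_ofReal hJpos.le] at h1
  -- Solving the logarithmic inequality for the mass gives `J_t ≤ J e^{tI/J}`, whose difference
  -- quotient tends to `I`.
  have hub : ∀ t, 0 < t → ((∫⁻ x, hopfLax T t F x).toReal - J) / t ≤
      J * ((Real.exp (t * (I / J)) - 1) / t) := by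
    intro t ht
    have h1 := hu.log_div_le T ht hI
    have hq : 0 < (∫⁻ x, hopfLax T t F x).toReal := hJpos.trans_le (hge t ht)
    rw [div_le_iff₀ ht, ← le_div_iff₀ hJpos] at h1
    rw [Real.log_le_iff_le_exp (div_pos hq hJpos), div_le_iff₀ hJpos] at h1
    have h2 : I * t / J = t * (I / J) := by ring
    rw [← mul_div_assoc]
    gcongr
    rw [h2] at h1
    linarith
  have hexp : Tendsto (fun t : ℝ => J * ((Real.exp (t * (I / J)) - 1) / t)) (𝓝[>] 0) (𝓝 I) := by
    have h1 : HasDerivAt (fun t : ℝ => Real.exp (t * (I / J))) (I / J) 0 := by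
      simpa using ((hasDerivAt_id (0 : ℝ)).mul_const (I / J)).exp
    have h2 := (h1.tendsto_slope.mono_left
      (nhdsWithin_mono _ fun t (ht : t ∈ Set.Ioi 0) => (ne_of_gt ht))).const_mul J
    rw [mul_div_cancel₀ _ hJpos.ne'] at h2
    refine h2.congr fun t => ?_
    simp [slope_def_field]
  have hlow : ENNReal.ofReal I ≤ liminf (fun t : ℝ =>
      ENNReal.ofReal (((∫⁻ x, hopfLax T t F x).toReal - J) / t)) (𝓝[>] 0) := by
    have hm : ∀ t, Measurable fun x => (hopfLax T t F x - F x) / ENNReal.ofReal t := fun t =>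
      ((measurable_hopfLax T t hFc).sub hFc.measurable).div_const _
    calc ENNReal.ofReal I
        = ∫⁻ x, ENNReal.ofReal (‖invAdjoint T (gradient u x)‖ ^ 2 / 2 * Real.exp (-u x)) :=
          ofReal_integral_eq_lintegral_ofReal hI (ae_of_all _ fun x => by positivity)
      _ ≤ ∫⁻ x, liminf (fun t : ℝ => (hopfLax T t F x - F x) / ENNReal.ofReal t) (𝓝[>] 0) :=
          lintegral_mono fun x => hu.le_liminf T x
      _ ≤ liminf (fun t : ℝ => ∫⁻ x, (hopfLax T t F x - F x) / ENNReal.ofReal t) (𝓝[>] 0) :=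
          lintegral_liminf_le hm
      _ = _ := by
          refine liminf_congr ?_
          filter_upwards [self_mem_nhdsWithin] with t ht
          have ht' : 0 < t := ht
          have hm : Measurable fun x => hopfLax T t F x - F x :=
            (measurable_hopfLax T t hFc).sub hFc.measurable
          simp_rw [div_eq_mul_inv]
          rw [lintegral_mul_const _ hm, lintegral_sub hFc.measurable
            (hJr ▸ ENNReal.ofReal_ne_top) (ae_of_all _ fun x => le_hopfLax T t F x), hJr,
            ENNReal.ofReal_mul (sub_nonneg.2 (hge t ht')), ENNReal.ofReal_sub _ hJpos.le,
            ENNReal.ofReal_toReal (hu.lintegral_hopfLax_ne_top T ht'),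
            ENNReal.ofReal_inv_of_pos ht']
  have hI0 : 0 ≤ I := integral_nonneg fun x => by positivity
  have hlim : Tendsto (fun t : ℝ => ENNReal.ofReal (((∫⁻ x, hopfLax T t F x).toReal - J) / t))
      (𝓝[>] 0) (𝓝 (ENNReal.ofReal I)) := by
    refine tendsto_of_le_liminf_of_limsup_le hlow ?_
    have h1 := (ENNReal.continuous_ofReal.tendsto _).comp hexp
    rw [← h1.limsup_eq]
    refine limsup_le_limsup ?_
    filter_upwards [self_mem_nhdsWithin] with t ht
    exact ENNReal.ofReal_le_ofReal (hub t ht)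
  have h2 := (ENNReal.tendsto_toReal ENNReal.ofReal_ne_top).comp hlim
  rw [ENNReal.toReal_ofReal hI0] at h2
  refine h2.congr' ?_
  filter_upwards [self_mem_nhdsWithin] with t ht
  have ht' : 0 < t := ht
  exact ENNReal.toReal_ofReal (div_nonneg (sub_nonneg.2 (hge t ht')) ht'.le)

end IsPotential

/-! ### Real-valued potentials -/

theorem expNeg_coe (u : Rn n → ℝ) : expNeg (fun x => (u x : EReal)) = fun x => Real.exp (-u x) := by
  funext x
  rw [expNeg, ← EReal.coe_neg, EReal.exp_coe, ENNReal.toReal_ofReal (Real.exp_pos _).le]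

theorem negLog_exp_neg (u : Rn n → ℝ) :
    negLog (fun x => Real.exp (-u x)) = fun x => (u x : EReal) := by
  rw [← expNeg_coe, negLog_expNeg _ fun x => EReal.coe_ne_bot _]

theorem negLog_gaussian : negLog (gaussian T) = fun x => ((‖T x‖ ^ 2 / 2 : ℝ) : EReal) :=
  negLog_exp_neg _

theorem rightMul_coe (u : Rn n → ℝ) (a : ℝ) :
    rightMul (fun x => (u x : EReal)) a = fun x => ((a * u (a⁻¹ • x) : ℝ) : EReal) := by
  funext x
  rw [rightMul, EReal.coe_mul]

theorem expNeg_infConv_coe (u v : Rn n → ℝ) (x : Rn n) :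
    expNeg (infConv (fun x => (u x : EReal)) (fun x => (v x : EReal))) x =
      (⨆ y, ENNReal.ofReal (Real.exp (-u (x - y))) * ENNReal.ofReal (Real.exp (-v y))).toReal := by
  have h : EReal.exp (-infConv (fun x => (u x : EReal)) (fun x => (v x : EReal)) x) =
      ⨆ y, EReal.exp (-((u (x - y) + v y : ℝ) : EReal)) := by
    have h1 : -infConv (fun x => (u x : EReal)) (fun x => (v x : EReal)) x =
        ⨆ y, -((u (x - y) + v y : ℝ) : EReal) := by
      rw [infConv]
      exact EReal.negOrderIso.map_iInf _
    rw [h1]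
    exact EReal.expOrderIso.map_iSup _
  rw [expNeg, h]
  congr 2
  funext y
  rw [← ENNReal.ofReal_mul (Real.exp_pos _).le, ← Real.exp_add, ← EReal.coe_neg, EReal.exp_coe,
    neg_add]

theorem asplundSum_gaussian (u : Rn n → ℝ) {t : ℝ} (ht : 0 < t) (x : Rn n) :
    asplundSum 1 (fun x => Real.exp (-u x)) t (gaussian T) x =
      (hopfLax T t (fun z => ENNReal.ofReal (Real.exp (-u z))) x).toReal := by
  rw [asplundSum, negLog_exp_neg, negLog_gaussian, rightMul_coe, rightMul_coe, expNeg_infConv_coe]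
  congr 2
  funext y
  simp only [inv_one, one_smul, one_mul]
  congr 3
  rw [map_smul, norm_smul, Real.norm_eq_abs, mul_pow, sq_abs]
  field_simp

/-! ### Legendre transforms of Gaussian exponents -/

theorem legendre_half_norm_sq (y : Rn n) :
    legendre (fun x => ((‖T x‖ ^ 2 / 2 : ℝ) : EReal)) y =
      ((‖invAdjoint T y‖ ^ 2 / 2 : ℝ) : EReal) := by
  refine le_antisymm (iSup_le fun x => ?_) (le_trans (le_of_eq ?_)
    (le_iSup _ (T.symm (invAdjoint T y))))
  · rw [← EReal.coe_sub, EReal.coe_le_coe_iff]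
    have := inner_sub_le T y x one_pos
    rw [real_inner_comm]
    simpa using this
  · rw [← EReal.coe_sub, EReal.coe_eq_coe_iff, real_inner_comm, inner_eq_inner_invAdjoint T,
      T.apply_symm_apply, real_inner_self_eq_norm_sq]
    ring

theorem invAdjoint_adjoint_apply (x : Rn n) :
    invAdjoint T (ContinuousLinearMap.adjoint (T : Rn n →L[ℝ] Rn n) x) = x := by
  refine ext_inner_right ℝ fun v => ?_
  rw [invAdjoint, ContinuousLinearMap.adjoint_inner_left, ContinuousLinearMap.adjoint_inner_left]
  simp

theorem legendre_half_norm_sq_invAdjoint (y : Rn n) :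
    legendre (fun x => ((‖invAdjoint T x‖ ^ 2 / 2 : ℝ) : EReal)) y =
      ((‖T y‖ ^ 2 / 2 : ℝ) : EReal) := by
  refine le_antisymm (iSup_le fun x => ?_) (le_trans (le_of_eq ?_)
    (le_iSup _ (ContinuousLinearMap.adjoint (T : Rn n →L[ℝ] Rn n) (T y))))
  · rw [← EReal.coe_sub, EReal.coe_le_coe_iff, inner_eq_inner_invAdjoint T]
    have h1 := real_inner_le_norm (invAdjoint T x) (T y)
    nlinarith [sq_nonneg (‖invAdjoint T x‖ - ‖T y‖)]
  · rw [← EReal.coe_sub, EReal.coe_eq_coe_iff, inner_eq_inner_invAdjoint T,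
      invAdjoint_adjoint_apply, real_inner_self_eq_norm_sq]
    ring

theorem supportFun_polar_gaussian (y : Rn n) :
    supportFun (polar (gaussian T)) y = ((‖T y‖ ^ 2 / 2 : ℝ) : EReal) := by
  rw [supportFun, polar, negLog_gaussian, negLog_expNeg _ fun x => by
    rw [legendre_half_norm_sq]; exact EReal.coe_ne_bot _]
  rw [show legendre (fun x => ((‖T x‖ ^ 2 / 2 : ℝ) : EReal)) =
    fun x => ((‖invAdjoint T x‖ ^ 2 / 2 : ℝ) : EReal) from funext (legendre_half_norm_sq T)]
  exact legendre_half_norm_sq_invAdjoint T y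

theorem exists_isPotential_of_mem_classA' {f : Rn n → ℝ} (hf : f ∈ classA' n) :
    ∃ u, IsPotential u ∧ f = fun x => Real.exp (-u x) := by
  obtain ⟨φ, ⟨⟨⟨-, hconv⟩, -, -⟩, hdom, hC2, hsup⟩, rfl⟩ := hf
  have hφ : φ = fun x => ((φ x).toReal : EReal) := by
    funext x
    have hx : x ∈ dom φ := hdom ▸ Set.mem_univ x
    exact (EReal.coe_toReal hx.2 hx.1).symm
  set u : Rn n → ℝ := fun x => (φ x).toReal with hu
  refine ⟨u, ⟨hC2, ⟨convex_univ, fun x _ y _ a b ha hb hab => ?_⟩, ?_⟩, ?_⟩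
  · have h := hconv x y b hb (by linarith)
    rw [show 1 - b = a by linarith, hφ] at h
    simp only at h
    rw [← EReal.coe_mul, ← EReal.coe_mul, ← EReal.coe_add, EReal.coe_le_coe_iff] at h
    exact h
  · obtain ⟨K, hK, hK'⟩ := mem_cocompact.1 (hsup.eventually (eventually_ge_atTop 1))
    obtain ⟨C, hC⟩ := hK.exists_bound_of_continuousOn
      (f := fun x => ‖x‖ - u x) (continuous_norm.sub hC2.1.continuous).continuousOn
    refine ⟨max C 0, fun x => ?_⟩
    by_cases hx : x ∈ K
    · have := (le_abs_self _).trans (hC x hx)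
      have := le_max_left C 0
      linarith
    · have h1 : 1 ≤ u x / ‖x‖ := hK' hx
      have h0 : 0 < ‖x‖ := by
        rcases (norm_nonneg x).eq_or_lt with h | h
        -- At the origin the quotient is 0 by convention, contradicting `1 ≤ u x / ‖x‖`.
        · rw [← h, div_zero] at h1; linarith
        · exact h
      rw [le_div_iff₀ h0] at h1
      have := le_max_right C 0
      linarith
  · rw [← expNeg_coe]
    exact congrArg expNeg hφ

/-! ### Integration against the surface area measure -/

namespace IsPotential

variable {u : Rn n → ℝ} (hu : IsPotential u)
include hu

theorem lintegral_surfaceAreaMeasure {g : Rn n → ℝ≥0∞} (hg : Measurable g) :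
    ∫⁻ x, g x ∂(surfaceAreaMeasure fun x => Real.exp (-u x)) =
      ∫⁻ x, ENNReal.ofReal (Real.exp (-u x)) * g (gradient u x) := by
  have hm := hu.continuous_gradient.measurable
  simp only [surfaceAreaMeasure, Real.log_exp, neg_neg]
  rw [lintegral_map hg hm]
  exact lintegral_withDensity_eq_lintegral_mul _
    hu.continuous_ofReal_exp_neg.measurable (hg.comp hm)

theorem integral_surfaceAreaMeasure {g : Rn n → ℝ} (hg : Continuous g) (hg0 : ∀ x, 0 ≤ g x) :
    ∫ x, g x ∂(surfaceAreaMeasure fun x => Real.exp (-u x)) =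
      ∫ x, g (gradient u x) * Real.exp (-u x) := by
  have h1 := hu.continuous_gradient
  have h2 := hu.continuous
  rw [integral_eq_lintegral_of_nonneg_ae (ae_of_all _ hg0) hg.aestronglyMeasurable,
    hu.lintegral_surfaceAreaMeasure (g := fun x => ENNReal.ofReal (g x)) (by fun_prop),
    integral_eq_lintegral_of_nonneg_ae (ae_of_all _ fun x =>
      mul_nonneg (hg0 _) (Real.exp_pos _).le)
      (Continuous.aestronglyMeasurable (by fun_prop))]
  congr 2
  funext x
  rw [mul_comm, ENNReal.ofReal_mul (hg0 _)]

theorem integrable_norm_gradient_sq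
    (h : Integrable (fun x => ‖x‖ ^ 2) (surfaceAreaMeasure fun x => Real.exp (-u x))) :
    Integrable fun x => ‖gradient u x‖ ^ 2 * Real.exp (-u x) := by
  have h1 := hu.continuous_gradient
  have h2 := hu.continuous
  refine ⟨Continuous.aestronglyMeasurable (by fun_prop), ?_⟩
  have h3 := h.2
  rw [hasFiniteIntegral_iff_ofReal (ae_of_all _ fun x => by positivity)] at h3 ⊢
  rw [hu.lintegral_surfaceAreaMeasure (by fun_prop)] at h3
  refine lt_of_eq_of_lt ?_ h3
  congr 1
  funext x
  rw [← ENNReal.ofReal_mul (Real.exp_pos _).le, mul_comm]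

theorem integrable_of_norm_le (hI : Integrable fun x => ‖gradient u x‖ ^ 2 * Real.exp (-u x))
    {g : Rn n → ℝ} (hg : Continuous g) {c : ℝ} (h : ∀ p, |g p| ≤ c * ‖p‖ ^ 2) :
    Integrable fun x => g (gradient u x) * Real.exp (-u x) := by
  have h1 := hu.continuous_gradient
  have h2 := hu.continuous
  refine (hI.const_mul c).mono' (Continuous.aestronglyMeasurable (by fun_prop))
    (ae_of_all _ fun x => ?_)
  rw [norm_mul, Real.norm_eq_abs, Real.norm_of_nonneg (Real.exp_pos _).le, ← mul_assoc]
  gcongr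
  exact h _

theorem hasFirstVariation_gaussian
    (hI : Integrable fun x => ‖gradient u x‖ ^ 2 * Real.exp (-u x)) :
    HasFirstVariation (fun x => Real.exp (-u x)) (gaussian T)
      (∫ x, ‖invAdjoint T (gradient u x)‖ ^ 2 / 2 * Real.exp (-u x)) := by
  have hI' : Integrable fun x => ‖invAdjoint T (gradient u x)‖ ^ 2 / 2 * Real.exp (-u x) := by
    refine hu.integrable_of_norm_le hI (g := fun p => ‖invAdjoint T p‖ ^ 2 / 2)
      (c := ‖invAdjoint T‖ ^ 2) (by fun_prop) fun p => ?_
    have h1 := pow_le_pow_left₀ (norm_nonneg _) ((invAdjoint T).le_opNorm p) 2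
    rw [abs_of_nonneg (by positivity), ← mul_pow]
    have : 0 ≤ ‖invAdjoint T p‖ ^ 2 := by positivity
    linarith
  refine (hu.tendsto_lintegral_hopfLax T hI').congr' ?_
  filter_upwards [self_mem_nhdsWithin] with t ht
  congr 2
  rw [totalMass, funext (asplundSum_gaussian T u ht), integral_toReal
    (measurable_hopfLax T t hu.continuous_ofReal_exp_neg).aemeasurable
    (ae_lt_top (measurable_hopfLax T t hu.continuous_ofReal_exp_neg)
      (hu.lintegral_hopfLax_ne_top T ht))]

end IsPotential

end Gaussian

variable {n : ℕ}

/-! ### Linear algebra -/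

/-- The determinant of a linear map of squared Hilbert–Schmidt norm at most `n` is at most one in
absolute value, with equality only for isometries. -/
theorem abs_det_le_one_of_sum_norm_sq_le (S : Rn n →ₗ[ℝ] Rn n) (hS : Function.Injective S)
    (h : ∑ i, ‖S (EuclideanSpace.basisFun (Fin n) ℝ i)‖ ^ 2 ≤ n) :
    |LinearMap.det S| ≤ 1 ∧ (1 ≤ |LinearMap.det S| → ∀ x, ‖S x‖ = ‖x‖) := by
  set A : Rn n →ₗ[ℝ] Rn n := LinearMap.adjoint S ∘ₗ S with hA
  have hinner : ∀ x y, inner ℝ x (A y) = inner ℝ (S x) (S y) := fun x y => by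
    rw [hA, LinearMap.comp_apply, LinearMap.adjoint_inner_right]
  have hsym : A.IsSymmetric := fun x y => by
    rw [hinner, real_inner_comm, hinner, real_inner_comm]
  have hn : Module.finrank ℝ (Rn n) = n := by simp
  set lam := hsym.eigenvalues hn with hlam
  set b := hsym.eigenvectorBasis hn with hb
  have hbi : ∀ i, A (b i) = lam i • b i := fun i => by
    exact hsym.apply_eigenvectorBasis hn i
  have hpos : ∀ i, 0 < lam i := by
    intro i
    have h1 : inner ℝ (b i) (A (b i)) = lam i := by
      rw [hbi, inner_smul_right, real_inner_self_eq_norm_sq, b.norm_eq_one]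
      simp
    rw [← h1, hinner, real_inner_self_eq_norm_sq]
    have h2 : S (b i) ≠ 0 := fun h0 => by
      have h3 : b i = 0 := hS (h0.trans (map_zero S).symm)
      have := b.norm_eq_one i
      rw [h3, norm_zero] at this
      exact zero_ne_one this
    have := norm_pos_iff.2 h2
    positivity
  have htr : ∑ i, lam i ≤ n := by
    refine le_trans (le_of_eq ?_) h
    have h1 := hsym.trace_eq_sum_eigenvalues hn
    simp only [RCLike.ofReal_real_eq_id, id] at h1
    rw [hlam, ← h1, LinearMap.trace_eq_sum_inner A (EuclideanSpace.basisFun (Fin n) ℝ)]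
    exact Finset.sum_congr rfl fun i _ => by rw [hinner, real_inner_self_eq_norm_sq]
  have hdet : LinearMap.det S ^ 2 = ∏ i, lam i := by
    have h1 := hsym.det_eq_prod_eigenvalues hn
    simp only [RCLike.ofReal_real_eq_id, id] at h1
    have h2 : LinearMap.det (LinearMap.adjoint S) = LinearMap.det S := by
      rw [← LinearMap.det_toMatrix (EuclideanSpace.basisFun (Fin n) ℝ).toBasis,
        LinearMap.toMatrix_adjoint, Matrix.det_conjTranspose, LinearMap.det_toMatrix]
      simp
    rw [hlam, ← h1, hA, LinearMap.det_comp, h2, sq]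
  have hprod : 0 < ∏ i, lam i := Finset.prod_pos fun i _ => hpos i
  have hlog : Real.log (∏ i, lam i) = ∑ i, Real.log (lam i) :=
    Real.log_prod fun i _ => (hpos i).ne'
  -- AM–GM in logarithmic form: `log λ ≤ λ - 1`, strict unless `λ = 1`, which also settles the
  -- equality case.
  have hle : ∀ i ∈ Finset.univ, Real.log (lam i) ≤ lam i - 1 := fun i _ =>
    Real.log_le_sub_one_of_pos (hpos i)
  have hsum : ∑ i, (lam i - 1) ≤ 0 := by
    rw [Finset.sum_sub_distrib]
    simpa using htr
  have hle1 : ∏ i, lam i ≤ 1 := by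
    rw [← Real.log_nonpos_iff hprod.le, hlog]
    exact (Finset.sum_le_sum hle).trans hsum
  refine ⟨?_, fun h1 x => ?_⟩
  · rw [← sq_le_one_iff_abs_le_one, hdet]
    exact hle1
  · have h2 : 1 ≤ ∏ i, lam i := by
      rw [← hdet, ← sq_abs]
      exact one_le_pow₀ h1
    have h3 : 0 ≤ ∑ i, Real.log (lam i) := hlog ▸ Real.log_nonneg h2
    have h4 : ∑ i, Real.log (lam i) = ∑ i, (lam i - 1) :=
      le_antisymm (Finset.sum_le_sum hle) (hsum.trans h3)
    have h5 := (Finset.sum_eq_sum_iff_of_le hle).1 h4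
    have h6 : ∀ i, lam i = 1 := fun i => by
      by_contra hne
      have := Real.log_lt_sub_one_of_pos (hpos i) hne
      exact this.ne (h5 i (Finset.mem_univ i))
    have h7 : A = LinearMap.id := b.toBasis.ext fun i => by
      simp [hbi, h6]
    have h8 := hinner x x
    rw [h7, LinearMap.id_apply, real_inner_self_eq_norm_sq, real_inner_self_eq_norm_sq] at h8
    exact ((sq_eq_sq₀ (norm_nonneg _) (norm_nonneg _)).1 h8).symm

open scoped MatrixOrder in
/-- A positive definite quadratic form is the squared norm of a linear isomorphism. -/
theorem exists_norm_sq_eq (A : Matrix (Fin n) (Fin n) ℝ) (hA : A.IsSymm)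
    (hpos : ∀ v : Rn n, v ≠ 0 → 0 < v.ofLp ⬝ᵥ A.mulVec v.ofLp) :
    ∃ T : Rn n ≃L[ℝ] Rn n, ∀ v, ‖T v‖ ^ 2 = v.ofLp ⬝ᵥ A.mulVec v.ofLp := by
  have hpsd : A.PosSemidef := by
    refine Matrix.PosSemidef.of_dotProduct_mulVec_nonneg (Matrix.isHermitian_iff_isSymm.2 hA)
      fun x => ?_
    by_cases hx : WithLp.toLp 2 x = (0 : Rn n)
    · have : x = 0 := by simpa using congrArg WithLp.ofLp hx
      simp [this]
    · simpa using (hpos _ hx).le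
  obtain ⟨B, hB⟩ := CStarAlgebra.nonneg_iff_eq_star_mul_self.mp hpsd.nonneg
  have hn : ∀ v : Rn n, ‖Matrix.toEuclideanLin B v‖ ^ 2 = v.ofLp ⬝ᵥ A.mulVec v.ofLp := by
    intro v
    rw [hB, ← Matrix.mulVec_mulVec, Matrix.dotProduct_mulVec, Matrix.star_eq_conjTranspose,
      Matrix.vecMul_conjTranspose, EuclideanSpace.norm_sq_eq]
    simp [dotProduct, sq]
  have hinj : Function.Injective (Matrix.toEuclideanLin B) := by
    rw [injective_iff_map_eq_zero]
    intro v hv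
    by_contra hne
    have := hpos v hne
    rw [← hn, hv] at this
    simp at this
  exact ⟨(LinearEquiv.ofInjectiveEndo _ hinj).toContinuousLinearEquiv, hn⟩

theorem gaussConst_pos (n : ℕ) : 0 < gaussConst n :=
  Real.rpow_pos_of_pos (by positivity) _

theorem totalMass_gaussian (T : Rn n ≃L[ℝ] Rn n) :
    totalMass (gaussian T) = |(LinearMap.det (T : Rn n →ₗ[ℝ] Rn n))⁻¹| * gaussConst n := by
  have hdet : LinearMap.det (T : Rn n →ₗ[ℝ] Rn n) ≠ 0 :=
    (LinearEquiv.isUnit_det' T.toLinearEquiv).ne_zero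
  have h1 : ∫ x, gaussian T x =
      ∫ v, Real.exp (-(1 / 2) * ‖v‖ ^ 2) ∂(Measure.map (T : Rn n →ₗ[ℝ] Rn n) volume) := by
    have hT : Measurable (T : Rn n →ₗ[ℝ] Rn n) := T.continuous.measurable
    have hc : Continuous fun v : Rn n => Real.exp (-(1 / 2) * ‖v‖ ^ 2) := by fun_prop
    rw [integral_map hT.aemeasurable hc.aestronglyMeasurable]
    refine integral_congr_ae (ae_of_all _ fun x => ?_)
    simp [gaussian]
    ring
  rw [totalMass, h1, Measure.map_linearMap_addHaar_eq_smul_addHaar _ hdet, integral_smul_measure,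
    GaussianFourier.integral_rexp_neg_mul_sq_norm (by norm_num),
    ENNReal.toReal_ofReal (abs_nonneg _), smul_eq_mul, gaussConst]
  congr 2
  · ring
  · simp

/-! ### The second moments of the surface area measure -/

/-- The second moment `∫ ⟨x, v⟩² dμ_f(x)` for `f = e^{-u}`, as an integral against `f`. -/
noncomputable def secondMoment (u : Rn n → ℝ) (v : Rn n) : ℝ :=
  ∫ x, inner ℝ (gradient u x) v ^ 2 * Real.exp (-u x)

namespace IsPotential

variable {u : Rn n → ℝ} (hu : IsPotential u)
include hu

theorem integral_inner_sq_surfaceAreaMeasure (v : Rn n) :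
    ∫ x, |inner ℝ x v| ^ 2 ∂(surfaceAreaMeasure fun x => Real.exp (-u x)) = secondMoment u v := by
  rw [hu.integral_surfaceAreaMeasure (g := fun x => |inner ℝ x v| ^ 2) (by fun_prop)
    fun x => by positivity]
  simp only [sq_abs, secondMoment]

theorem integrable_inner_mul_inner
    (hI : Integrable fun x => ‖gradient u x‖ ^ 2 * Real.exp (-u x)) (v w : Rn n) :
    Integrable fun x => inner ℝ (gradient u x) v * inner ℝ (gradient u x) w * Real.exp (-u x) := by
  refine hu.integrable_of_norm_le hI (g := fun p => inner ℝ p v * inner ℝ p w)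
    (c := ‖v‖ * ‖w‖) (by fun_prop) fun p => ?_
  rw [abs_mul]
  calc |inner ℝ p v| * |inner ℝ p w| ≤ (‖p‖ * ‖v‖) * (‖p‖ * ‖w‖) := by
        gcongr <;> exact abs_real_inner_le_norm _ _
    _ = _ := by ring

theorem integrable_inner_sq
    (hI : Integrable fun x => ‖gradient u x‖ ^ 2 * Real.exp (-u x)) (v : Rn n) :
    Integrable fun x => inner ℝ (gradient u x) v ^ 2 * Real.exp (-u x) := by
  simpa only [sq] using hu.integrable_inner_mul_inner (v := v) (w := v) (by simpa only [sq] using hI)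

/-- If `⟨∇u, v⟩` vanished identically, so would its derivative along `v`, contradicting positivity
of the Hessian at `(v, v)`. -/
theorem secondMoment_pos (hI : Integrable fun x => ‖gradient u x‖ ^ 2 * Real.exp (-u x))
    {v : Rn n} (hv : v ≠ 0) : 0 < secondMoment u v := by
  have h1 := hu.continuous_gradient
  have h2 := hu.continuous
  have hex : ∃ x, inner ℝ (gradient u x) v ≠ 0 := by
    by_contra! h
    simp only [inner_gradient_left] at h
    have hd : DifferentiableAt ℝ (fderiv ℝ u) 0 :=
      ((hu.contDiff.fderiv_right (m := 1) (by norm_num)).differentiable (by norm_num)) 0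
    have h3 : fderiv ℝ (fun x => fderiv ℝ u x v) 0 v = fderiv ℝ (fderiv ℝ u) 0 v v := by
      rw [fderiv_clm_apply hd (differentiableAt_const v)]
      simp
    have h4 : (fun x => fderiv ℝ u x v) = fun _ => 0 := funext h
    rw [h4] at h3
    have := hu.isC2Plus.2 0 v hv
    rw [← h3] at this
    simp at this
  obtain ⟨x, hx⟩ := hex
  have hx' : inner ℝ (gradient u x) v ^ 2 * Real.exp (-u x) ≠ 0 :=
    mul_ne_zero (pow_ne_zero 2 hx) (Real.exp_pos _).ne'
  exact integral_pos_of_integrable_nonneg_nonzero (x := x) (by fun_prop)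
    (hu.integrable_inner_sq hI v) (fun x => by positivity) hx'

/-- Parseval in the standard basis, using `⟨P⁻*p, eᵢ⟩ = ⟨p, P⁻¹eᵢ⟩`. -/
theorem integral_norm_invAdjoint_sq
    (hI : Integrable fun x => ‖gradient u x‖ ^ 2 * Real.exp (-u x)) (P : Rn n ≃L[ℝ] Rn n) :
    ∫ x, ‖invAdjoint P (gradient u x)‖ ^ 2 / 2 * Real.exp (-u x) =
      (∑ i, secondMoment u (P.symm (EuclideanSpace.basisFun (Fin n) ℝ i))) / 2 := by
  simp only [secondMoment]
  rw [← integral_finsetSum _ fun i _ => hu.integrable_inner_sq hI _, ← integral_div]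
  congr 1
  funext x
  rw [← Finset.sum_mul, ← (EuclideanSpace.basisFun (Fin n) ℝ).sum_sq_inner_left]
  simp only [invAdjoint, ContinuousLinearMap.adjoint_inner_left, ContinuousLinearEquiv.coe_coe]
  ring

/-- Produces the optimal `T`. The factor `n / (2J)` makes it saturate the constraint. -/
theorem exists_norm_sq_eq_secondMoment
    (hI : Integrable fun x => ‖gradient u x‖ ^ 2 * Real.exp (-u x)) :
    ∃ T : Rn n ≃L[ℝ] Rn n, ∀ v, ‖T v‖ ^ 2 =
      n / (2 * ∫ x, Real.exp (-u x)) * secondMoment u v := by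
  set c : ℝ := n / (2 * ∫ x, Real.exp (-u x)) with hc
  set e := EuclideanSpace.basisFun (Fin n) ℝ with he
  set A : Matrix (Fin n) (Fin n) ℝ := Matrix.of fun i j =>
    c * ∫ x, inner ℝ (gradient u x) (e i) * inner ℝ (gradient u x) (e j) * Real.exp (-u x) with hA
  have hval : ∀ v : Rn n, v.ofLp ⬝ᵥ A.mulVec v.ofLp = c * secondMoment u v := by
    intro v
    have h1 : ∀ x, inner ℝ (gradient u x) v ^ 2 * Real.exp (-u x) = ∑ i, ∑ j, v i * v j *
        (inner ℝ (gradient u x) (e i) * inner ℝ (gradient u x) (e j) * Real.exp (-u x)) := by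
      intro x
      have h2 : inner ℝ (gradient u x) v = ∑ i, v i * inner ℝ (gradient u x) (e i) := by
        rw [← e.sum_inner_mul_inner]
        refine Finset.sum_congr rfl fun i _ => ?_
        rw [mul_comm, real_inner_comm v]
        simp [he, EuclideanSpace.inner_single_right]
      rw [h2, sq, Finset.sum_mul_sum, Finset.sum_mul]
      refine Finset.sum_congr rfl fun i _ => ?_
      rw [Finset.sum_mul]
      exact Finset.sum_congr rfl fun j _ => by ring
    simp only [secondMoment, h1]
    rw [integral_finsetSum _ fun i _ => integrable_finsetSum _ fun j _ =>
      (hu.integrable_inner_mul_inner hI (e i) (e j)).const_mul _, dotProduct, Finset.mul_sum]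
    refine Finset.sum_congr rfl fun i _ => ?_
    rw [integral_finsetSum _ fun j _ =>
      (hu.integrable_inner_mul_inner hI (e i) (e j)).const_mul _, Matrix.mulVec, dotProduct,
      Finset.mul_sum, Finset.mul_sum]
    refine Finset.sum_congr rfl fun j _ => ?_
    rw [integral_const_mul, hA, Matrix.of_apply]
    ring
  have hsymm : A.IsSymm := by
    ext i j
    simp only [hA, Matrix.transpose_apply, Matrix.of_apply]
    congr 2
    funext x
    ring
  obtain ⟨T, hT⟩ := exists_norm_sq_eq A hsymm fun v hv => by
    rw [hval]
    have hn : 0 < n := by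
      rcases Nat.eq_zero_or_pos n with rfl | h
      · exact absurd (Subsingleton.elim v 0) hv
      · exact h
    have := hu.integral_exp_neg_pos
    have := hu.secondMoment_pos hI hv
    positivity
  exact ⟨T, fun v => (hT v).trans (hval v)⟩

/-! ### The extremal problem -/

/-- The first variation formula turns the constraint into a Hilbert–Schmidt bound on `T P⁻¹`. -/
theorem isFeasible_iff (hI : Integrable fun x => ‖gradient u x‖ ^ 2 * Real.exp (-u x))
    {T : Rn n ≃L[ℝ] Rn n}
    (hT : ∀ v, ‖T v‖ ^ 2 = n / (2 * ∫ x, Real.exp (-u x)) * secondMoment u v)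
    (P : Rn n ≃L[ℝ] Rn n) :
    IsFeasible (fun x => Real.exp (-u x)) (gaussian P) ↔
      ∑ i, ‖T (P.symm (EuclideanSpace.basisFun (Fin n) ℝ i))‖ ^ 2 ≤ n := by
  have hvar := hu.hasFirstVariation_gaussian P hI
  have hJ := hu.integral_exp_neg_pos
  have h1 : IsFeasible (fun x => Real.exp (-u x)) (gaussian P) ↔
      (∫ x, ‖invAdjoint P (gradient u x)‖ ^ 2 / 2 * Real.exp (-u x)) /
        (∫ x, Real.exp (-u x)) ≤ 1 := by
    refine ⟨?_, fun h => ⟨_, hvar, h⟩⟩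
    rintro ⟨d, hd, hd1⟩
    rwa [← tendsto_nhds_unique hd hvar]
  rw [h1, hu.integral_norm_invAdjoint_sq hI, div_le_one hJ]
  simp only [hT]
  rw [← Finset.mul_sum]
  -- For `n = 0` the factor `n / (2J)` vanishes and cannot be cancelled, but both sides hold
  -- trivially.
  rcases Nat.eq_zero_or_pos n with rfl | hn
  · simp [hJ.le]
  · have hn' : (0 : ℝ) < n := by exact_mod_cast hn
    rw [div_mul_eq_mul_div (n : ℝ), div_le_iff₀ (by positivity : 0 < 2 * ∫ x, Real.exp (-u x)),
      mul_le_mul_iff_of_pos_left hn']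
    constructor <;> intro h <;> linarith

theorem isSLogSolution_iff (hI : Integrable fun x => ‖gradient u x‖ ^ 2 * Real.exp (-u x))
    {T : Rn n ≃L[ℝ] Rn n}
    (hT : ∀ v, ‖T v‖ ^ 2 = n / (2 * ∫ x, Real.exp (-u x)) * secondMoment u v)
    (P : Rn n ≃L[ℝ] Rn n) :
    IsSLogSolution (fun x => Real.exp (-u x)) (gaussian P) ↔ ∀ y, ‖P y‖ = ‖T y‖ := by
  have hdet : ∀ Q : Rn n ≃L[ℝ] Rn n, 0 < |LinearMap.det (Q : Rn n →ₗ[ℝ] Rn n)| := fun Q =>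
    abs_pos.2 (LinearEquiv.isUnit_det' Q.toLinearEquiv).ne_zero
  have hmass : ∀ Q R : Rn n ≃L[ℝ] Rn n,
      totalMass (gaussian Q) / gaussConst n ≤ totalMass (gaussian R) / gaussConst n ↔
        |LinearMap.det (R : Rn n →ₗ[ℝ] Rn n)| ≤ |LinearMap.det (Q : Rn n →ₗ[ℝ] Rn n)| := by
    intro Q R
    have hc := gaussConst_pos n
    rw [div_le_div_iff_of_pos_right hc, totalMass_gaussian, totalMass_gaussian,
      mul_le_mul_iff_of_pos_right hc, abs_inv, abs_inv, inv_le_inv₀ (hdet Q) (hdet R)]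
  have hfeasT : IsFeasible (fun x => Real.exp (-u x)) (gaussian T) := by
    rw [hu.isFeasible_iff hI hT]
    simp
  have key : ∀ Q : Rn n ≃L[ℝ] Rn n, IsFeasible (fun x => Real.exp (-u x)) (gaussian Q) →
      |LinearMap.det (T : Rn n →ₗ[ℝ] Rn n)| ≤ |LinearMap.det (Q : Rn n →ₗ[ℝ] Rn n)| ∧
      (|LinearMap.det (Q : Rn n →ₗ[ℝ] Rn n)| ≤ |LinearMap.det (T : Rn n →ₗ[ℝ] Rn n)| →
        ∀ y, ‖Q y‖ = ‖T y‖) := by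
    intro Q hQ
    rw [hu.isFeasible_iff hI hT] at hQ
    -- For `S = T Q⁻¹` feasibility is the Hilbert–Schmidt bound and `det S · det Q = det T`; `S`
    -- being an isometry means `‖Q y‖ = ‖T y‖`.
    set S : Rn n →ₗ[ℝ] Rn n := ((Q.symm.trans T : Rn n ≃L[ℝ] Rn n) : Rn n →ₗ[ℝ] Rn n) with hS
    have hcomp : S ∘ₗ (Q : Rn n →ₗ[ℝ] Rn n) = T := by
      ext1 x
      simp [hS]
    have hd : |LinearMap.det S| * |LinearMap.det (Q : Rn n →ₗ[ℝ] Rn n)| =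
        |LinearMap.det (T : Rn n →ₗ[ℝ] Rn n)| := by
      rw [← abs_mul, ← LinearMap.det_comp, hcomp]
    obtain ⟨h1, h2⟩ := abs_det_le_one_of_sum_norm_sq_le S
      (Q.symm.trans T).injective (by simpa [hS] using hQ)
    refine ⟨?_, fun h y => ?_⟩
    · rw [← hd]
      exact mul_le_of_le_one_left (abs_nonneg _) h1
    · rw [← hd, le_mul_iff_one_le_left (hdet Q)] at h
      have := h2 h (Q y)
      simpa [hS] using this.symm
  constructor
  · rintro ⟨-, hfeas, hmax⟩
    exact (key P hfeas).2 ((hmass T P).1 (hmax T hfeasT))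
  · intro h
    have hPT : gaussian P = gaussian T := by
      funext x
      simp only [gaussian, h]
    rw [hPT]
    exact ⟨⟨T, rfl⟩, hfeasT, fun Q hQ => (hmass Q T).2 (key Q hQ).1⟩

end IsPotential

end LogConcave

theorem mainTheorem1 (n : ℕ) (f : LogConcave.Rn n → ℝ) (hf : f ∈ LogConcave.classA' n)
    (hmom : Integrable (fun x : LogConcave.Rn n => ‖x‖ ^ 2) (LogConcave.surfaceAreaMeasure f)) :
    (∃! g : LogConcave.Rn n → ℝ, LogConcave.IsSLogSolution f g) ∧
      ∀ T : LogConcave.Rn n ≃L[ℝ] LogConcave.Rn n,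
        LogConcave.IsSLogSolution f (LogConcave.gaussian T) ↔
          ∀ y : LogConcave.Rn n,
            LogConcave.supportFun (LogConcave.polar (LogConcave.gaussian T)) y =
              (((n : ℝ) / (4 * LogConcave.totalMass f) *
                ∫ x, |inner ℝ x y| ^ 2 ∂(LogConcave.surfaceAreaMeasure f) : ℝ) : EReal) := by
  obtain ⟨u, hu, rfl⟩ := LogConcave.exists_isPotential_of_mem_classA' hf
  have hI := hu.integrable_norm_gradient_sq hmom
  obtain ⟨T₀, hT₀⟩ := hu.exists_norm_sq_eq_secondMoment hI
  have hiff := hu.isSLogSolution_iff hI hT₀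
  refine ⟨⟨LogConcave.gaussian T₀, (hiff T₀).2 fun _ => rfl, ?_⟩, fun T => ?_⟩
  · rintro g hg
    obtain ⟨P, rfl⟩ := hg.1
    funext x
    simp only [LogConcave.gaussian, (hiff P).1 hg x]
  · rw [hiff]
    refine forall_congr' fun y => ?_
    rw [LogConcave.supportFun_polar_gaussian, EReal.coe_eq_coe_iff,
      hu.integral_inner_sq_surfaceAreaMeasure, ← sq_eq_sq₀ (norm_nonneg _) (norm_nonneg _), hT₀]
    have h1 : (n : ℝ) / (4 * LogConcave.totalMass fun x => Real.exp (-u x)) *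
        LogConcave.secondMoment u y =
        (n : ℝ) / (2 * ∫ x, Real.exp (-u x)) * LogConcave.secondMoment u y / 2 := by
      rw [LogConcave.totalMass]
      ring
    rw [h1]
    constructor <;> intro h <;> linarith
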